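/- **Proposition 3.4.** Let $d\in\mathbb N$, $0<\alpha<1$, $0<\beta\le 2$, $0<\gamma<\beta/2$, $c>0$, $L,a\in\mathbb R$. On a probability space let $(\tau_s)_{s\ge 0}$ be an $\alpha$-stable subordinator, i.e. a nondecreasing Lévy process started at $0$ with $$\mathbb E[e^{iz\tau_1}]=\exp\Big(\int_0^\infty (e^{izy}-1)\,\frac{\alpha}{\Gamma(1-\alpha)}\,y^{-\alpha-1}\,dy\Big),\qquad z\in\mathbb R,$$ and put $T_t=\inf\{s>0:\ t-\tau_s<a\}$ for $t>a$. For every $x\in\mathbb R^d$ let $(X^x_s)_{s\ge 0}$ be a process independent of $\tau$ that is an isotropic $\beta$-stable process on $\mathbb R^d$ started at $x$: a càdlàg Lévy process with $X^x_0=x$ a.s. such that $X^x_1-X^x_0$ is a $\beta$-stable random vector all of whose coordinates $X^x_{1,(j)}-X^x_{0,(j)}$ have the same symmetric characteristic function $z\mapsto e^{-c|z|^\beta}$. Let $\phi:\mathbb R^d\to\mathbb R$ be continuous and let $g:\mathbb R^d\to\mathbb R$ satisfy $$|g(x)-g(y)|\le L\sum_{j=1}^d|x_{(j)}-y_{(j)}|^\gamma,\qquad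 x,y\in\mathbb R^d.$$ For $t>a$, $x\in\mathbb R^d$ and a step length $h>0$ define $$Z(t,x)=\phi(X^x_{T_t})+\int_0^{T_t}g(X^x_s)\,ds,\qquad Y_h(t,x)=\phi(X^x_{T_t})+\sum_{i=1}^{\lfloor T_t/h\rfloor}h\,g\big(X^x_{(i-1)h}\big).$$ Then for all $t>a$ and $x\in\mathbb R^d$ there exists a constant $M^3_{t,x}$, which does not depend on $h$, such that for every $h>0$ the random variable $Z(t,x)-Y_h(t,x)$ is square integrable and $$\mathbb E\big[|Z(t,x)-Y_h(t,x)|^2\big]\le M^3_{t,x}\,h^{2\gamma/\beta}.$$ -/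

import Mathlib

open MeasureTheory ProbabilityTheory Filter Topology
open scoped NNReal

namespace FractionalMonteCarlo

/-- A path is cadlag: right-continuous with left limits at every time. -/
def IsCadlagPath {E : Type*} [TopologicalSpace E] (f : ℝ≥0 → E) : Prop :=
  ∀ s : ℝ≥0, ContinuousWithinAt f (Set.Ici s) s ∧ ∃ l : E, Tendsto f (𝓝[<] s) (𝓝 l)

/-- `X` is a Levy process under `P`, started at the point `x`. -/
structure IsLevyProcess {Ω E : Type*} [MeasurableSpace Ω] [NormedAddCommGroup E]
    [MeasurableSpace E] (X : ℝ≥0 → Ω → E) (x : E) (P : Measure Ω) : Prop where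
  measurable : ∀ s, Measurable (X s)
  start : ∀ᵐ ω ∂P, X 0 ω = x
  indep_increments : HasIndepIncrements X P
  stationary_increments : ∀ s u : ℝ≥0,
    IdentDistrib (fun ω => X (s + u) ω - X s ω) (fun ω => X u ω - X 0 ω) P P
  cadlag : ∀ᵐ ω ∂P, IsCadlagPath fun s => X s ω

/-- `μ` is a `β`-stable law: if `U, U'` are independent with law `μ` and `r, r' > 0`, then
`r U + r' U'` has the law of `(r ^ β + r' ^ β) ^ (1 / β) U + v` for some vector `v`. -/
def IsStableLaw {E : Type*} [NormedAddCommGroup E] [NormedSpace ℝ E] [MeasurableSpace E]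
    (β : ℝ) (μ : Measure E) : Prop :=
  ∀ r r' : ℝ, 0 < r → 0 < r' → ∃ v : E,
    (μ.map fun y => r • y) ∗ (μ.map fun y => r' • y) =
      μ.map fun y => (r ^ β + r' ^ β) ^ (1 / β) • y + v

/-- `X` is an isotropic `β`-stable process on `ℝ^d` started at `x`: a Levy process such that
`X 1 - X 0` is a `β`-stable random vector whose coordinates all have the same symmetric stable
law, with characteristic function `z ↦ exp (-c |z| ^ β)`. -/
structure IsIsotropicStableProcess {Ω : Type*} [MeasurableSpace Ω] {d : ℕ} (β c : ℝ)
    (X : ℝ≥0 → Ω → EuclideanSpace ℝ (Fin d)) (x : EuclideanSpace ℝ (Fin d))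
    (P : Measure Ω) : Prop where
  levy : IsLevyProcess X x P
  stable : IsStableLaw β (P.map fun ω => X 1 ω - X 0 ω)
  coord_charFun : ∀ (j : Fin d) (z : ℝ),
    charFun (P.map fun ω => X 1 ω j - X 0 ω j) z = Complex.exp (-((c * |z| ^ β : ℝ) : ℂ))

/-- `τ` is an `α`-stable subordinator: a nondecreasing Levy process started at `0` with
`E[exp (i z τ 1)] = exp (∫_0^∞ (exp (i z y) - 1) (α / Γ(1 - α)) y ^ (-α - 1) dy)`. -/
structure IsStableSubordinator {Ω : Type*} [MeasurableSpace Ω] (α : ℝ) (τ : ℝ≥0 → Ω → ℝ)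
    (P : Measure Ω) : Prop where
  levy : IsLevyProcess τ 0 P
  monotone : ∀ᵐ ω ∂P, Monotone fun s => τ s ω
  charFun_one : ∀ z : ℝ, charFun (P.map (τ 1)) z =
    Complex.exp (∫ y in Set.Ioi (0 : ℝ),
      (Complex.exp (Complex.I * z * y) - 1) *
        ((α / Real.Gamma (1 - α) * y ^ (-α - 1) : ℝ) : ℂ))

/-- `T_t = inf {s > 0 : t - τ_s < a}`. -/
noncomputable def exitTime {Ω : Type*} (τ : ℝ≥0 → Ω → ℝ) (a t : ℝ) (ω : Ω) : ℝ≥0 :=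
  sInf {s : ℝ≥0 | 0 < s ∧ t - τ s ω < a}

/-- `Z = φ(X_T) + ∫_0^T g(X_s) ds`, for a process `X` and a random time `T`. -/
noncomputable def exactFunctional {Ω E : Type*} (φ g : E → ℝ) (X : ℝ≥0 → Ω → E)
    (T : Ω → ℝ≥0) (ω : Ω) : ℝ :=
  φ (X (T ω) ω) + ∫ s in (0 : ℝ)..(T ω : ℝ), g (X s.toNNReal ω)

/-- `Y_h = φ(X_T) + ∑_{i = 1}^{⌊T / h⌋} h g(X_{(i - 1) h})`; below the summation index is
shifted by one. -/
noncomputable def discretizedFunctional {Ω E : Type*} (φ g : E → ℝ) (X : ℝ≥0 → Ω → E)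
    (T : Ω → ℝ≥0) (h : ℝ) (ω : Ω) : ℝ :=
  φ (X (T ω) ω) +
    ∑ i ∈ Finset.range ⌊(T ω : ℝ) / h⌋₊, h * g (X (Real.toNNReal (i * h)) ω)

end FractionalMonteCarlo

/-! The `φ` terms cancel, so the error is that of a left Riemann sum for `G s = g (X s)` on `[0,
T]`, with `T` random but independent of `X`. Put `θ = 2γ/β`. Three facts carry the proof.

Mean square regularity: a coordinate increment of `X` over time `u` has the law of `u ^ (1/β)` times
the unit-time increment, whose moment of order `2γ < β` is finite because `1 - exp (-c|z|^β) ≤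
c|z|^β`. The Hölder bound on `g` then gives `E|G (s+u) - G s|² ≤ K u^θ`.

Second moment of `T`: if `T > n ≥ 1` then `τ n ≤ t - a`, which has probability at most `exp (t - a)
ρ^n` with `ρ = E exp (-τ 1) < 1`.

Combination (`lintegral_sq_integral_sub_riemannSum_le`): Cauchy-Schwarz on each path bounds the
squared error by twice the sum of `T ∫_0^T |G s - G (⌊s/h⌋h)|² ds` and `r ∫_{T-r}^T |G s|² ds`,
where `r = T - ⌊T/h⌋h`. By Tonelli and independence, the expectation of `G` may be taken at each
fixed `s`. The first term yields `K h^θ E T²`. In the second, `r ≤ h` and `r ≤ T` give `r² ≤ h^θ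
T^(2-θ)`, so no smallness of `h` is needed. -/

namespace FractionalMonteCarlo

/-! ### Moments from the characteristic function near zero -/

/-- If `1 - charFun μ z = O(|z| ^ β)`, then `μ` has finite absolute moments of every order
`p < β`. -/
lemma lintegral_abs_rpow_lt_top_of_norm_one_sub_charFun_le {μ : Measure ℝ}
    [IsProbabilityMeasure μ] {β C p : ℝ} (hp : 0 < p) (hpβ : p < β)
    (h : ∀ z, ‖1 - charFun μ z‖ ≤ C * |z| ^ β) :
    ∫⁻ y, ENNReal.ofReal (|y| ^ p) ∂μ < ⊤ := by
  have hβ : 0 < β := hp.trans hpβ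
  have hC : 0 ≤ C := by
    have := (norm_nonneg _).trans (h 1)
    simpa using this
  -- The truncation inequality controls the tail by the integral of `1 - charFun μ` over an interval
  -- of length `4/r`, where the integrand is at most `C (2/r)^β`.
  have tail : ∀ r : ℝ, 0 < r → μ.real {y | r < |y|} ≤ 2 * C * 2 ^ β * r ^ (-β) := by
    intro r hr
    have hr2 : 0 < 2 * r⁻¹ := by positivity
    refine (measureReal_abs_gt_le_integral_charFun hr).trans ?_
    have : ‖∫ t in (-2 * r⁻¹)..(2 * r⁻¹), 1 - charFun μ t‖
        ≤ (C * (2 * r⁻¹) ^ β) * |2 * r⁻¹ - (-2 * r⁻¹)| := by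
      refine intervalIntegral.norm_integral_le_of_norm_le_const fun t ht => (h t).trans ?_
      rw [Set.uIoc_of_le (by linarith)] at ht
      gcongr
      rw [abs_le]
      constructor <;> linarith [ht.1, ht.2]
    calc 2⁻¹ * r * ‖∫ t in (-2 * r⁻¹)..(2 * r⁻¹), 1 - charFun μ t‖
        ≤ 2⁻¹ * r * ((C * (2 * r⁻¹) ^ β) * |2 * r⁻¹ - (-2 * r⁻¹)|) := by gcongr
      _ = 2 * C * 2 ^ β * r ^ (-β) := by
          rw [show 2 * r⁻¹ - (-2 * r⁻¹) = 4 * r⁻¹ by ring, abs_of_pos (by positivity),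
            Real.mul_rpow (by norm_num) (by positivity), Real.inv_rpow hr.le, Real.rpow_neg hr.le]
          field_simp
          ring
  rw [lintegral_rpow_eq_lintegral_meas_lt_mul μ (Eventually.of_forall fun y => abs_nonneg y)
    (by fun_prop) hp]
  refine ENNReal.mul_lt_top ENNReal.ofReal_lt_top ?_
  -- Layer-cake integral cut at `1`: below, probabilities are at most `1` and `p > 0` suffices;
  -- above, the tail bound leaves `t ^ (p - 1 - β)`, integrable since `p < β`.
  rw [← Set.Ioc_union_Ioi_eq_Ioi (zero_le_one' ℝ)]
  refine (lintegral_union_le _ _ _).trans_lt (ENNReal.add_lt_top.2 ⟨?_, ?_⟩)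
  · have hi : IntegrableOn (fun t : ℝ => t ^ (p - 1)) (Set.Ioc 0 1) := by
      rw [← intervalIntegrable_iff_integrableOn_Ioc_of_le zero_le_one]
      exact intervalIntegral.intervalIntegrable_rpow' (by linarith)
    refine lt_of_le_of_lt (lintegral_mono fun t => ?_) hi.lintegral_lt_top
    exact mul_le_of_le_one_left (zero_le) prob_le_one
  · have hi : IntegrableOn (fun t : ℝ => 2 * C * 2 ^ β * t ^ (p - 1 - β)) (Set.Ioi 1) :=
      (integrableOn_Ioi_rpow_of_lt (by linarith) one_pos).const_mul _
    refine lt_of_le_of_lt (setLIntegral_mono' measurableSet_Ioi fun t ht => ?_)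
      hi.lintegral_lt_top
    have ht0 : (0 : ℝ) < t := one_pos.trans ht
    rw [← ofReal_measureReal, ← ENNReal.ofReal_mul measureReal_nonneg]
    refine ENNReal.ofReal_le_ofReal ?_
    calc μ.real {y | t < |y|} * t ^ (p - 1)
        ≤ 2 * C * 2 ^ β * t ^ (-β) * t ^ (p - 1) := by
          gcongr
          exact tail t ht0
      _ = 2 * C * 2 ^ β * t ^ (p - 1 - β) := by
          rw [mul_assoc, ← Real.rpow_add ht0]
          congr 2
          ring

/-! ### Laws and scaling of symmetric stable Lévy processes -/

section Levy

variable {Ω : Type*} [MeasurableSpace Ω] {P : Measure Ω} [IsProbabilityMeasure P]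

lemma IsLevyProcess.charFun_increment_add {Y : ℝ≥0 → Ω → ℝ} {y : ℝ} (hY : IsLevyProcess Y y P)
    (u v : ℝ≥0) (z : ℝ) :
    charFun (P.map fun ω => Y (u + v) ω - Y 0 ω) z =
      charFun (P.map fun ω => Y u ω - Y 0 ω) z * charFun (P.map fun ω => Y v ω - Y 0 ω) z := by
  have hm := hY.measurable
  have hi : IndepFun (Y u - Y 0) (Y (u + v) - Y u) P :=
    hY.indep_increments.indepFun_sub_sub zero_le (le_self_add)
  have h1 := congrFun (hi.charFun_map_fun_add_eq_mul ((hm _).sub (hm _)).aemeasurable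
    ((hm _).sub (hm _)).aemeasurable) z
  have h2 : P.map (Y (u + v) - Y u) = P.map fun ω => Y v ω - Y 0 ω :=
    (hY.stationary_increments u v).map_eq
  rw [Pi.mul_apply, h2] at h1
  rw [show (fun ω => Y u ω - Y 0 ω) = Y u - Y 0 from rfl, ← h1]
  congr 3
  ext ω
  simp

lemma IsLevyProcess.charFun_increment_nsmul {Y : ℝ≥0 → Ω → ℝ} {y : ℝ}
    (hY : IsLevyProcess Y y P) (n : ℕ) (u : ℝ≥0) (z : ℝ) :
    charFun (P.map fun ω => Y (n • u) ω - Y 0 ω) z =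
      charFun (P.map fun ω => Y u ω - Y 0 ω) z ^ n := by
  induction n with
  | zero => simp
  | succ n ih => rw [succ_nsmul, hY.charFun_increment_add, ih, pow_succ]

/-- Dominated convergence along right-continuous paths; this is why the times approach `u` from
above. -/
lemma IsLevyProcess.tendsto_charFun_increment {Y : ℝ≥0 → Ω → ℝ} {y : ℝ}
    (hY : IsLevyProcess Y y P) {u : ℝ≥0} {v : ℕ → ℝ≥0} (hv : ∀ n, u ≤ v n)
    (hvu : Tendsto v atTop (𝓝 u)) (z : ℝ) :
    Tendsto (fun n => charFun (P.map fun ω => Y (v n) ω - Y 0 ω) z) atTop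
      (𝓝 (charFun (P.map fun ω => Y u ω - Y 0 ω) z)) := by
  have hm := hY.measurable
  have key : ∀ w, charFun (P.map fun ω => Y w ω - Y 0 ω) z =
      ∫ ω, Complex.exp (z * (Y w ω - Y 0 ω : ℝ) * Complex.I) ∂P := by
    intro w
    rw [charFun_apply_real, integral_map (φ := fun ω => Y w ω - Y 0 ω)
      ((hm _).sub (hm _)).aemeasurable (by fun_prop)]
  simp_rw [key]
  refine tendsto_integral_of_dominated_convergence (fun _ => 1) (fun n => ?_)
    (integrable_const 1) (fun n => ?_) ?_
  · have := hm (v n)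
    have := hm 0
    exact Measurable.aestronglyMeasurable (by fun_prop)
  · refine Eventually.of_forall fun ω => ?_
    rw [← Complex.ofReal_mul, Complex.norm_exp_ofReal_mul_I]
  · filter_upwards [hY.cadlag] with ω hω
    have h1 : Tendsto (fun n => Y (v n) ω) atTop (𝓝 (Y u ω)) :=
      (hω u).1.tendsto.comp (tendsto_nhdsWithin_iff.2 ⟨hvu, Eventually.of_forall hv⟩)
    have h2 : Continuous fun r : ℝ => Complex.exp (z * (r - Y 0 ω : ℝ) * Complex.I) := by
      fun_prop
    exact (h2.tendsto _).comp h1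

/-- A continuous function on `ℝ` with values in the `n`-th roots of unity is constant. -/
lemma eq_one_of_continuous_of_pow_eq_one {f : ℝ → ℂ} (hf : Continuous f) {n : ℕ} (hn : n ≠ 0)
    (h1 : ∀ z, f z ^ n = 1) (h0 : f 0 = 1) (z : ℝ) : f z = 1 := by
  have hfin : {w : ℂ | w ^ n = 1}.Finite := by
    refine (Polynomial.nthRoots n (1 : ℂ)).toFinset.finite_toSet.subset fun w hw => ?_
    simpa [Polynomial.mem_nthRoots (Nat.pos_of_ne_zero hn)] using hw
  rw [← h0]
  exact isPreconnected_univ.constant_of_mapsTo (T := {w : ℂ | w ^ n = 1}) hfin.isDiscrete hf.continuousOn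
    (fun z _ => h1 z) (Set.mem_univ _) (Set.mem_univ _)

/-- The one-dimensional laws of a symmetric stable Lévy process are determined by the law at
time `1`. -/
lemma IsLevyProcess.charFun_increment_of_stable {Y : ℝ≥0 → Ω → ℝ} {y β c : ℝ} (hβ : 0 < β)
    (hY : IsLevyProcess Y y P)
    (h1 : ∀ z, charFun (P.map fun ω => Y 1 ω - Y 0 ω) z =
      Complex.exp (-((c * |z| ^ β : ℝ) : ℂ))) (u : ℝ≥0) (z : ℝ) :
    charFun (P.map fun ω => Y u ω - Y 0 ω) z =
      Complex.exp (-((c * u * |z| ^ β : ℝ) : ℂ)) := by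
  have hm := hY.measurable
  have hprob : ∀ u, IsProbabilityMeasure (P.map fun ω => Y u ω - Y 0 ω) := fun u =>
    Measure.isProbabilityMeasure_map ((hm _).sub (hm _)).aemeasurable
  -- The `n`-th power of the characteristic function at time `1/n` is known. The choice of complex
  -- root is settled by continuity in `z`: the quotient by the expected value is an `n`-th root of
  -- unity, equal to `1` at `z = 0`.
  have root : ∀ (n : ℕ), n ≠ 0 → ∀ z : ℝ,
      charFun (P.map fun ω => Y (n : ℝ≥0)⁻¹ ω - Y 0 ω) z =
        Complex.exp (-((c * (n : ℝ)⁻¹ * |z| ^ β : ℝ) : ℂ)) := by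
    intro n hn z
    have hnR : (n : ℝ≥0) ≠ 0 := by exact_mod_cast hn
    have hnC : (n : ℂ) ≠ 0 := by exact_mod_cast hn
    have hcont : Continuous fun z : ℝ => charFun (P.map fun ω => Y (n : ℝ≥0)⁻¹ ω - Y 0 ω) z *
        Complex.exp ((c * (n : ℝ)⁻¹ * |z| ^ β : ℝ) : ℂ) := by
      have hr : Continuous fun z : ℝ => |z| ^ β :=
        continuous_abs.rpow_const fun _ => Or.inr hβ.le
      have := hprob (n : ℝ≥0)⁻¹
      refine Continuous.mul ?_ (by fun_prop)
      fun_prop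
    have := eq_one_of_continuous_of_pow_eq_one hcont hn (fun z => ?_) ?_ z
    · rw [Complex.exp_neg]
      exact eq_inv_of_mul_eq_one_left this
    · rw [mul_pow, ← hY.charFun_increment_nsmul, nsmul_eq_mul, mul_inv_cancel₀ hnR, h1,
        ← Complex.exp_nat_mul, ← Complex.exp_add]
      rw [Complex.exp_eq_one_iff]
      refine ⟨0, ?_⟩
      push_cast
      field_simp
      simp
    · have := hprob (n : ℝ≥0)⁻¹
      simp [Real.zero_rpow hβ.ne']
  have rat : ∀ m n : ℕ, n ≠ 0 →
      charFun (P.map fun ω => Y (m * (n : ℝ≥0)⁻¹) ω - Y 0 ω) z =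
        Complex.exp (-((c * (m * (n : ℝ)⁻¹) * |z| ^ β : ℝ) : ℂ)) := by
    intro m n hn
    rw [← nsmul_eq_mul, hY.charFun_increment_nsmul, root n hn, ← Complex.exp_nat_mul]
    congr 1
    push_cast
    ring
  -- Rational times `⌈u(n+1)⌉/(n+1)` decrease the problem to `rat` while staying above `u`.
  have hceil : Tendsto (fun n : ℕ => (⌈(u : ℝ≥0) * ((n + 1 : ℕ) : ℝ≥0)⌉₊ : ℝ≥0)
      * ((n + 1 : ℕ) : ℝ≥0)⁻¹) atTop (𝓝 u) := by
    have := (tendsto_nat_ceil_mul_div_atTop (R := ℝ) u.2).comp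
      (tendsto_natCast_atTop_atTop.comp (tendsto_add_atTop_nat 1))
    rw [← NNReal.tendsto_coe]
    refine this.congr fun n => ?_
    simp only [Function.comp, NNReal.coe_mul, NNReal.coe_natCast, NNReal.coe_inv, div_eq_mul_inv]
    congr 2
  have hlim := hY.tendsto_charFun_increment (fun n => ?_) hceil z
  · refine tendsto_nhds_unique hlim ?_
    have hc : Continuous fun r : ℝ => Complex.exp (-((c * r * |z| ^ β : ℝ) : ℂ)) := by fun_prop
    have := (hc.tendsto u).comp (NNReal.tendsto_coe.2 hceil)
    refine this.congr fun n => ?_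
    rw [rat _ _ (Nat.succ_ne_zero n)]
    simp [Function.comp]
  · rw [← div_eq_mul_inv, le_div_iff₀ (by positivity)]
    exact Nat.le_ceil _

/-- Scaling of the absolute moments of the increments of a symmetric stable Lévy process. -/
lemma IsLevyProcess.lintegral_abs_increment_rpow {Y : ℝ≥0 → Ω → ℝ} {y β c : ℝ} (hβ : 0 < β)
    (hY : IsLevyProcess Y y P)
    (h1 : ∀ z, charFun (P.map fun ω => Y 1 ω - Y 0 ω) z =
      Complex.exp (-((c * |z| ^ β : ℝ) : ℂ))) (s u : ℝ≥0) (p : ℝ) :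
    ∫⁻ ω, ENNReal.ofReal (|Y (s + u) ω - Y s ω| ^ p) ∂P =
      ENNReal.ofReal ((u : ℝ) ^ (p / β)) *
        ∫⁻ ω, ENNReal.ofReal (|Y 1 ω - Y 0 ω| ^ p) ∂P := by
  have hm := hY.measurable
  have hd : ∀ s t, Measurable fun ω => Y s ω - Y t ω := fun s t => (hm s).sub (hm t)
  have hlaw : P.map (fun ω => Y u ω - Y 0 ω) =
      P.map fun ω => (u : ℝ) ^ (1 / β) * (Y 1 ω - Y 0 ω) := by
    have := Measure.isProbabilityMeasure_map (μ := P) (hd u 0).aemeasurable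
    have := Measure.isProbabilityMeasure_map (μ := P)
      ((hd 1 0).const_mul ((u : ℝ) ^ (1 / β))).aemeasurable
    refine Measure.ext_of_charFun (funext fun z => ?_)
    rw [hY.charFun_increment_of_stable hβ h1, charFun_map_mul_comp (hd 1 0).aemeasurable, h1]
    congr 3
    have hu : 0 ≤ (u : ℝ) ^ (1 / β) := Real.rpow_nonneg u.coe_nonneg _
    rw [abs_mul, abs_of_nonneg hu, Real.mul_rpow hu (abs_nonneg _),
      ← Real.rpow_mul u.coe_nonneg, one_div_mul_cancel hβ.ne', Real.rpow_one]
    ring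
  have hf : Measurable fun r : ℝ => ENNReal.ofReal (|r| ^ p) := by fun_prop
  have e1 : ∫⁻ ω, ENNReal.ofReal (|Y (s + u) ω - Y s ω| ^ p) ∂P =
      ∫⁻ ω, ENNReal.ofReal (|Y u ω - Y 0 ω| ^ p) ∂P :=
    ((hY.stationary_increments s u).comp hf).lintegral_eq
  have e2 : ∫⁻ ω, ENNReal.ofReal (|Y u ω - Y 0 ω| ^ p) ∂P =
      ∫⁻ ω, ENNReal.ofReal (|(u : ℝ) ^ (1 / β) * (Y 1 ω - Y 0 ω)| ^ p) ∂P := by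
    rw [← lintegral_map hf (hd u 0), hlaw, lintegral_map hf ((hd 1 0).const_mul _)]
  rw [e1, e2, ← lintegral_const_mul _ (by fun_prop)]
  refine lintegral_congr fun ω => ?_
  rw [← ENNReal.ofReal_mul (by positivity), abs_mul, Real.mul_rpow (abs_nonneg _) (abs_nonneg _),
    abs_of_nonneg (by positivity), ← Real.rpow_mul u.coe_nonneg]
  congr 3
  ring

lemma IsLevyProcess.lintegral_abs_increment_one_rpow_lt_top {Y : ℝ≥0 → Ω → ℝ} {y β c p : ℝ}
    (hY : IsLevyProcess Y y P) (hc : 0 ≤ c)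
    (h1 : ∀ z, charFun (P.map fun ω => Y 1 ω - Y 0 ω) z =
      Complex.exp (-((c * |z| ^ β : ℝ) : ℂ))) (hp : 0 < p) (hpβ : p < β) :
    ∫⁻ ω, ENNReal.ofReal (|Y 1 ω - Y 0 ω| ^ p) ∂P < ⊤ := by
  have hd : Measurable fun ω => Y 1 ω - Y 0 ω := (hY.measurable 1).sub (hY.measurable 0)
  have := Measure.isProbabilityMeasure_map (μ := P) hd.aemeasurable
  rw [← lintegral_map (f := fun r : ℝ => ENNReal.ofReal (|r| ^ p)) (by fun_prop) hd]
  refine lintegral_abs_rpow_lt_top_of_norm_one_sub_charFun_le (C := c) hp hpβ fun z => ?_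
  rw [h1]
  have h0 : 0 ≤ c * |z| ^ β := by positivity
  rw [← Complex.ofReal_neg, ← Complex.ofReal_exp, ← Complex.ofReal_one, ← Complex.ofReal_sub,
    Complex.norm_real, Real.norm_eq_abs, abs_of_nonneg (by simpa using h0)]
  linarith [Real.add_one_le_exp (-(c * |z| ^ β))]

end Levy

/-! ### Second moment and measurability of the exit time -/

section ExitTime

/-- The Lévy exponent of the `α`-stable subordinator is given by an integrable function. -/
lemma integrableOn_stableExponent {α : ℝ} (hα : 0 < α) (hα1 : α < 1) :
    IntegrableOn (fun y : ℝ => (Complex.exp (Complex.I * (1 : ℝ) * y) - 1) *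
      ((α / Real.Gamma (1 - α) * y ^ (-α - 1) : ℝ) : ℂ)) (Set.Ioi 0) := by
  have hΓ : 0 < Real.Gamma (1 - α) := Real.Gamma_pos_of_pos (by linarith)
  have hk : 0 < α / Real.Gamma (1 - α) := by positivity
  have hmeas : Measurable (fun y : ℝ => (Complex.exp (Complex.I * (1 : ℝ) * y) - 1) *
      ((α / Real.Gamma (1 - α) * y ^ (-α - 1) : ℝ) : ℂ)) := by fun_prop
  have hnorm : ∀ y : ℝ, 0 < y → ‖(Complex.exp (Complex.I * (1 : ℝ) * y) - 1) *
      ((α / Real.Gamma (1 - α) * y ^ (-α - 1) : ℝ) : ℂ)‖ =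
      ‖Complex.exp (Complex.I * y) - 1‖ * (α / Real.Gamma (1 - α) * y ^ (-α - 1)) := by
    intro y hy
    rw [norm_mul, Complex.norm_real, Real.norm_of_nonneg (by positivity)]
    simp
  -- Near `0`, `|exp (iy) - 1| ≤ y` leaves `y ^ (-α)`, integrable since `α < 1`; beyond `1`, the
  -- bound `2` leaves `y ^ (-α - 1)`, integrable since `α > 0`.
  rw [← Set.Ioc_union_Ioi_eq_Ioi (zero_le_one' ℝ)]
  refine IntegrableOn.union ?_ ?_
  · have hi : IntegrableOn (fun t : ℝ => α / Real.Gamma (1 - α) * t ^ (-α)) (Set.Ioc 0 1) := by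
      rw [← intervalIntegrable_iff_integrableOn_Ioc_of_le zero_le_one]
      exact (intervalIntegral.intervalIntegrable_rpow' (by linarith)).const_mul _
    refine Integrable.mono' hi hmeas.aestronglyMeasurable ?_
    filter_upwards [ae_restrict_mem measurableSet_Ioc] with y hy
    rw [hnorm y hy.1]
    have h1 : ‖Complex.exp (Complex.I * y) - 1‖ ≤ y := by
      simpa [abs_of_pos hy.1] using Real.norm_exp_I_mul_ofReal_sub_one_le (x := y)
    have h2 : 0 ≤ y ^ (-α - 1) := Real.rpow_nonneg hy.1.le _
    calc _ ≤ y * (α / Real.Gamma (1 - α) * y ^ (-α - 1)) := by gcongr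
      _ = α / Real.Gamma (1 - α) * y ^ (-α) := by
        rw [Real.rpow_sub_one hy.1.ne']
        field_simp [hy.1.ne']
  · have hi : IntegrableOn (fun t : ℝ => 2 * (α / Real.Gamma (1 - α) * t ^ (-α - 1)))
        (Set.Ioi 1) :=
      ((integrableOn_Ioi_rpow_of_lt (by linarith) one_pos).const_mul _).const_mul _
    refine Integrable.mono' hi hmeas.aestronglyMeasurable ?_
    filter_upwards [ae_restrict_mem measurableSet_Ioi] with y hy
    have hy0 : (0 : ℝ) < y := one_pos.trans hy
    rw [hnorm y hy0]
    have h1 : ‖Complex.exp (Complex.I * y) - 1‖ ≤ 2 := by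
      refine (norm_sub_le _ _).trans ?_
      rw [mul_comm, Complex.norm_exp_ofReal_mul_I]
      norm_num
    have h2 : 0 ≤ y ^ (-α - 1) := Real.rpow_nonneg hy0.le _
    gcongr

/-- The exponent has real part `-∫ (1 - cos y) k(y) dy < 0`, with `k` the Lévy density, whereas `exp
w = 1` forces `w` to be purely imaginary. This rules out a subordinator with `τ 1 = 0` almost
surely. -/
lemma exp_stableExponent_ne_one {α : ℝ} (hα : 0 < α) (hα1 : α < 1) :
    Complex.exp (∫ y in Set.Ioi (0 : ℝ), (Complex.exp (Complex.I * (1 : ℝ) * y) - 1) *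
      ((α / Real.Gamma (1 - α) * y ^ (-α - 1) : ℝ) : ℂ)) ≠ 1 := by
  have hΓ : 0 < Real.Gamma (1 - α) := Real.Gamma_pos_of_pos (by linarith)
  -- Indispensable: a non-integrable exponent would have Bochner integral `0` by convention, hence
  -- exponential `1`.
  have hint := integrableOn_stableExponent hα hα1
  intro h
  obtain ⟨n, hn⟩ := Complex.exp_eq_one_iff.1 h
  have hre := congrArg Complex.re hn
  have hre0 : ((n : ℂ) * (2 * Real.pi * Complex.I)).re = 0 := by simp
  rw [hre0] at hre
  have hre' : ∫ y in Set.Ioi (0 : ℝ), Complex.re ((Complex.exp (Complex.I * (1 : ℝ) * y) - 1) *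
      ((α / Real.Gamma (1 - α) * y ^ (-α - 1) : ℝ) : ℂ)) = Complex.re _ := integral_re hint
  rw [hre] at hre'
  have hval : ∀ y : ℝ, Complex.re ((Complex.exp (Complex.I * (1 : ℝ) * y) - 1) *
      ((α / Real.Gamma (1 - α) * y ^ (-α - 1) : ℝ) : ℂ)) =
      -((1 - Real.cos y) * (α / Real.Gamma (1 - α) * y ^ (-α - 1))) := by
    intro y
    rw [Complex.re_mul_ofReal, mul_comm Complex.I, mul_assoc, mul_comm Complex.I]
    simp only [Complex.ofReal_one, one_mul, Complex.sub_re, Complex.exp_ofReal_mul_I_re,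
      Complex.one_re]
    ring
  have hint' := hint.re.neg
  have h0 : ∫ y in Set.Ioi (0 : ℝ),
      (1 - Real.cos y) * (α / Real.Gamma (1 - α) * y ^ (-α - 1)) = 0 := by
    rw [← neg_eq_zero, ← integral_neg]
    exact (integral_congr_ae (Eventually.of_forall fun y => (hval y).symm)).trans hre'
  rw [setIntegral_eq_zero_iff_of_nonneg_ae] at h0
  · have h1 := ae_mono (Measure.restrict_mono (show Set.Ioo (0 : ℝ) 1 ⊆ Set.Ioi 0 from
      Set.Ioo_subset_Ioi_self) le_rfl) h0
    have h2 : ∀ᵐ y ∂(volume.restrict (Set.Ioo (0 : ℝ) 1)), False := by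
      filter_upwards [h1, ae_restrict_mem measurableSet_Ioo] with y hy hy01
      have hcos : Real.cos y < 1 := by
        rw [← Real.cos_zero]
        exact Real.cos_lt_cos_of_nonneg_of_le_pi le_rfl (by linarith [Real.pi_gt_three, hy01.2])
          hy01.1
      have : 0 < (1 - Real.cos y) * (α / Real.Gamma (1 - α) * y ^ (-α - 1)) :=
        mul_pos (by linarith) (mul_pos (by positivity) (Real.rpow_pos_of_pos hy01.1 _))
      exact this.ne' hy
    rw [eventually_false_iff_eq_bot, ae_eq_bot, Measure.restrict_eq_zero, Real.volume_Ioo] at h2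
    norm_num at h2
  · filter_upwards [ae_restrict_mem measurableSet_Ioi] with y hy
    exact mul_nonneg (by linarith [Real.cos_le_one y])
      (mul_nonneg (by positivity) (Real.rpow_nonneg (le_of_lt hy) _))
  · refine hint'.congr (Eventually.of_forall fun y => ?_)
    exact (congrArg Neg.neg (hval y)).trans (neg_neg _)

variable {Ω : Type*} [MeasurableSpace Ω] {P : Measure Ω} [IsProbabilityMeasure P]
  {α : ℝ} {τ : ℝ≥0 → Ω → ℝ}

/-- The Laplace transform of a subordinator at integer times. -/
lemma IsLevyProcess.lintegral_exp_neg_increment {Y : ℝ≥0 → Ω → ℝ} {y : ℝ}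
    (hY : IsLevyProcess Y y P) (n : ℕ) :
    ∫⁻ ω, ENNReal.ofReal (Real.exp (-(Y n ω - Y 0 ω))) ∂P =
      (∫⁻ ω, ENNReal.ofReal (Real.exp (-(Y 1 ω - Y 0 ω))) ∂P) ^ n := by
  have hm := hY.measurable
  have hf : Measurable fun r : ℝ => ENNReal.ofReal (Real.exp (-r)) := by fun_prop
  induction n with
  | zero => simp
  | succ n ih =>
    have hi : IndepFun (Y n - Y 0) (Y (n + 1) - Y n) P :=
      hY.indep_increments.indepFun_sub_sub zero_le le_self_add
    have h1 := lintegral_mul_eq_lintegral_mul_lintegral_of_indepFun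
      (hf.comp ((hm _).sub (hm _))) (hf.comp ((hm _).sub (hm _))) (hi.comp hf hf)
    have h2 : ∫⁻ ω, ENNReal.ofReal (Real.exp (-(Y (n + 1) ω - Y n ω))) ∂P =
        ∫⁻ ω, ENNReal.ofReal (Real.exp (-(Y 1 ω - Y 0 ω))) ∂P :=
      ((hY.stationary_increments n 1).comp hf).lintegral_eq
    rw [pow_succ, ← ih, ← h2]
    refine Eq.trans (lintegral_congr fun ω => ?_) h1
    simp only [Pi.mul_apply, Function.comp, Pi.sub_apply]
    rw [← ENNReal.ofReal_mul (Real.exp_nonneg _), ← Real.exp_add]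
    push_cast
    congr 2
    ring

/-- Since `exp (-τ 1) ≤ 1` almost surely, mean `1` would force `τ 1 = 0` almost surely,
contradicting `exp_stableExponent_ne_one`. -/
lemma IsStableSubordinator.lintegral_exp_neg_lt_one (hα : 0 < α) (hα1 : α < 1)
    (hτ : IsStableSubordinator α τ P) :
    ∫⁻ ω, ENNReal.ofReal (Real.exp (-(τ 1 ω - τ 0 ω))) ∂P < 1 := by
  have hm := hτ.levy.measurable
  have hm1 := hm 1
  have hm0 := hm 0
  have hle : ∀ᵐ ω ∂P, ENNReal.ofReal (Real.exp (-(τ 1 ω - τ 0 ω))) ≤ 1 := by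
    filter_upwards [hτ.monotone] with ω hω
    rw [ENNReal.ofReal_le_one, Real.exp_le_one_iff]
    have : τ 0 ω ≤ τ 1 ω := hω zero_le_one
    linarith
  by_contra hge
  rw [not_lt] at hge
  have hae := ae_eq_of_ae_le_of_lintegral_le (g := fun _ => 1) hle
    (((lintegral_mono_ae hle).trans_lt (by simp)).ne) (by fun_prop) (by simpa using hge)
  have hzero : τ 1 =ᵐ[P] fun _ => 0 := by
    filter_upwards [hae, hτ.levy.start] with ω h1 h0
    rw [ENNReal.ofReal_eq_one, Real.exp_eq_one_iff, h0] at h1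
    linarith
  refine exp_stableExponent_ne_one hα hα1 ?_
  rw [← hτ.charFun_one 1, Measure.map_congr hzero]
  simp

/-- Chernoff bound: the indicator of `τ n ≤ b` is at most `exp (b - τ n)`, and the Laplace transform
is a power by independence and stationarity. -/
lemma IsStableSubordinator.measure_le_le (hτ : IsStableSubordinator α τ P) (b : ℝ) (n : ℕ) :
    P {ω | τ n ω ≤ b} ≤ ENNReal.ofReal (Real.exp b) *
      (∫⁻ ω, ENNReal.ofReal (Real.exp (-(τ 1 ω - τ 0 ω))) ∂P) ^ n := by
  have hm := hτ.levy.measurable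
  have hmn := hm n
  have hm0 := hm 0
  rw [← hτ.levy.lintegral_exp_neg_increment, ← lintegral_const_mul _ (by fun_prop),
    ← lintegral_indicator_one (measurableSet_le (hm n) measurable_const)]
  refine lintegral_mono_ae ?_
  filter_upwards [hτ.levy.start] with ω h0
  by_cases hω : τ n ω ≤ b
  · rw [Set.indicator_of_mem (show ω ∈ {ω | τ n ω ≤ b} from hω), Pi.one_apply, ← ENNReal.ofReal_mul (Real.exp_nonneg _),
      ← Real.exp_add, ENNReal.one_le_ofReal, Real.one_le_exp_iff, h0]
    linarith
  · simp [Set.indicator_of_notMem (show ω ∉ {ω | τ n ω ≤ b} from hω)]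

lemma exitTime_le_of_lt {Ω : Type*} {τ : ℝ≥0 → Ω → ℝ} {a t : ℝ} {s : ℝ≥0} {ω : Ω} (hs : 0 < s) (h : t - a < τ s ω) :
    exitTime τ a t ω ≤ s :=
  csInf_le (OrderBot.bddBelow _) ⟨hs, by linarith⟩

/-- The exit time of a stable subordinator has a finite second moment. -/
lemma IsStableSubordinator.lintegral_exitTime_sq_lt_top (hα : 0 < α) (hα1 : α < 1)
    (hτ : IsStableSubordinator α τ P) {a t : ℝ} (hat : a < t) :
    ∫⁻ ω, (exitTime τ a t ω : ENNReal) ^ 2 ∂P < ⊤ := by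
  have hm := hτ.levy.measurable
  set ρ := ∫⁻ ω, ENNReal.ofReal (Real.exp (-(τ 1 ω - τ 0 ω))) ∂P with hρ
  have hρ1 : ρ < 1 := hτ.lintegral_exp_neg_lt_one hα hα1
  have hms : ∀ n : ℕ, MeasurableSet {ω | τ n ω ≤ t - a} := fun n =>
    measurableSet_le (hm n) measurable_const
  -- Uses `N² = ∑_{n<N} (2n+1)` with `N = ⌈T⌉`. The index `n = 0` is treated apart, because the exit
  -- set contains only positive times; there `τ 0 = 0` suffices.
  have hpt : ∀ᵐ ω ∂P, (exitTime τ a t ω : ENNReal) ^ 2 ≤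
      ∑' n : ℕ, (2 * n + 1 : ENNReal) * {ω | τ n ω ≤ t - a}.indicator 1 ω := by
    filter_upwards [hτ.levy.start] with ω h0
    set T := exitTime τ a t ω with hT
    have hmem : ∀ n ∈ Finset.range ⌈T⌉₊, ω ∈ {ω | τ n ω ≤ t - a} := by
      intro n hn
      rw [Finset.mem_range, Nat.lt_ceil] at hn
      rcases Nat.eq_zero_or_pos n with rfl | hpos
      · simp [h0, hat.le]
      · by_contra hlt
        exact absurd (exitTime_le_of_lt (by exact_mod_cast hpos) (not_le.1 hlt)) (not_le.2 hn)
    calc (T : ENNReal) ^ 2 ≤ ((⌈T⌉₊ : ℕ) : ENNReal) ^ 2 := by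
          gcongr
          exact_mod_cast Nat.le_ceil T
      _ = ∑ n ∈ Finset.range ⌈T⌉₊, (2 * n + 1 : ENNReal) := by
          generalize ⌈T⌉₊ = N
          induction N with
          | zero => simp
          | succ N ih =>
            rw [Finset.sum_range_succ, ← ih]
            push_cast
            ring
      _ = ∑ n ∈ Finset.range ⌈T⌉₊,
            (2 * n + 1 : ENNReal) * {ω | τ n ω ≤ t - a}.indicator 1 ω := by
          refine Finset.sum_congr rfl fun n hn => ?_
          rw [Set.indicator_of_mem (hmem n hn), Pi.one_apply, mul_one]
      _ ≤ _ := ENNReal.sum_le_tsum _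
  have hsum : Summable fun n : ℕ => (2 * n + 1 : ℝ) * ρ.toReal ^ n := by
    have hr : ‖ρ.toReal‖ < 1 := by
      rw [Real.norm_of_nonneg ENNReal.toReal_nonneg]
      exact ENNReal.toReal_lt_of_lt_ofReal (by simpa using hρ1)
    have h1 := (summable_pow_mul_geometric_of_norm_lt_one 1 hr).mul_left 2
    have h0 := summable_geometric_of_norm_lt_one hr
    refine (h1.add h0).congr fun n => ?_
    ring
  calc ∫⁻ ω, (exitTime τ a t ω : ENNReal) ^ 2 ∂P
      ≤ ∫⁻ ω, ∑' n : ℕ, (2 * n + 1 : ENNReal) * {ω | τ n ω ≤ t - a}.indicator 1 ω ∂P :=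
        lintegral_mono_ae hpt
    _ = ∑' n : ℕ, (2 * n + 1 : ENNReal) * P {ω | τ n ω ≤ t - a} := by
        rw [lintegral_tsum fun n =>
          ((measurable_one.indicator (hms n)).const_mul _).aemeasurable]
        refine tsum_congr fun n => ?_
        rw [lintegral_const_mul _ (measurable_one.indicator (hms n)),
          lintegral_indicator_one (hms n)]
    _ ≤ ∑' n : ℕ, ENNReal.ofReal (Real.exp (t - a)) *
          ENNReal.ofReal ((2 * n + 1 : ℝ) * ρ.toReal ^ n) := by
        refine ENNReal.tsum_le_tsum fun n => ?_
        have hc : ENNReal.ofReal ((2 * n + 1 : ℝ) * ρ.toReal ^ n) = (2 * n + 1) * ρ ^ n := by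
          rw [ENNReal.ofReal_mul (by positivity), ENNReal.ofReal_pow ENNReal.toReal_nonneg,
            ENNReal.ofReal_toReal (hρ1.trans ENNReal.one_lt_top).ne]
          congr 1
          rw [ENNReal.ofReal_add (by positivity) zero_le_one]
          simp
        rw [hc]
        calc (2 * n + 1) * P {ω | τ n ω ≤ t - a}
            ≤ (2 * n + 1) * (ENNReal.ofReal (Real.exp (t - a)) * ρ ^ n) := by
              gcongr
              exact hτ.measure_le_le _ n
          _ = _ := by ring
    _ < ⊤ := by
        rw [ENNReal.tsum_mul_left]
        exact ENNReal.mul_lt_top ENNReal.ofReal_lt_top hsum.tsum_ofReal_lt_top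

open Classical in
/-- The exit time of a nondecreasing process is almost surely a measurable function of the
path. -/
lemma exists_measurable_exitTime {Ω : Type*} [MeasurableSpace Ω] {P : Measure Ω}
    {τ : ℝ≥0 → Ω → ℝ} (hmono : ∀ᵐ ω ∂P, Monotone fun s => τ s ω) (a t : ℝ) :
    ∃ F : (ℝ≥0 → ℝ) → ℝ≥0, Measurable F ∧
      ∀ᵐ ω ∂P, exitTime τ a t ω = F fun s => τ s ω := by
  -- Monotonicity lets the infimum run over rationals. If the path never exits, the infimum `⊤`
  -- becomes `0` under `toNNReal`, matching `sInf ∅ = 0` in `ℝ≥0`.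
  refine ⟨fun p => (⨅ q : ℚ, if 0 < Real.toNNReal q ∧ t - p (Real.toNNReal q) < a then
    (Real.toNNReal q : ENNReal) else ⊤).toNNReal, ?_, ?_⟩
  · refine ENNReal.measurable_toNNReal.comp (Measurable.iInf fun q => ?_)
    refine Measurable.ite ?_ measurable_const measurable_const
    exact (MeasurableSet.const _).inter
      (measurableSet_lt (measurable_const.sub (measurable_pi_apply _)) measurable_const)
  · filter_upwards [hmono] with ω hω
    set S : Set ℝ≥0 := {s | 0 < s ∧ t - τ s ω < a} with hS
    change sInf S = _
    rcases S.eq_empty_or_nonempty with hE | hne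
    · have : ∀ q : ℚ, ¬ (0 < Real.toNNReal q ∧ t - τ (Real.toNNReal q) ω < a) := fun q hq =>
        (hE ▸ (show Real.toNNReal q ∈ S from hq) : Real.toNNReal q ∈ (∅ : Set ℝ≥0))
      simp only [if_neg (this _), iInf_const, hE, NNReal.sInf_empty, ENNReal.toNNReal_top]
    · have key : (⨅ q : ℚ, if 0 < Real.toNNReal q ∧ t - τ (Real.toNNReal q) ω < a then
          (Real.toNNReal q : ENNReal) else ⊤) = ((sInf S : ℝ≥0) : ENNReal) := by
        refine le_antisymm (le_of_forall_gt fun r hr => ?_) (le_iInf fun q => ?_)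
        · obtain ⟨r', hr', hr'r⟩ := ENNReal.lt_iff_exists_nnreal_btwn.1 hr
          obtain ⟨s, hs, hsr⟩ := exists_lt_of_csInf_lt hne (ENNReal.coe_lt_coe.1 hr')
          obtain ⟨q, -, hsq, hqr⟩ := (NNReal.lt_iff_exists_rat_btwn s r').1 hsr
          refine (iInf_le _ q).trans_lt ?_
          have hτle : τ s ω ≤ τ (Real.toNNReal q) ω := hω hsq.le
          rw [if_pos ⟨hs.1.trans hsq, by linarith [hs.2]⟩]
          exact (ENNReal.coe_lt_coe.2 hqr).trans hr'r
        · split_ifs with hq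
          · exact ENNReal.coe_le_coe.2 (csInf_le (OrderBot.bddBelow _) hq)
          · exact le_top
      rw [key, ENNReal.toNNReal_coe]

end ExitTime

/-! ### Joint measurability in time and chance -/

section JointMeasurability

variable {Ω : Type*} [MeasurableSpace Ω] {P : Measure Ω}

/-- Evaluating a process along a measurable function with values in a grid. -/
lemma measurable_process_comp_grid {S E : Type*} [MeasurableSpace S] [MeasurableSpace E]
    {X : ℝ≥0 → Ω → E} (hX : ∀ s, Measurable (X s)) {N : S → ℕ} (hN : Measurable N)
    (v : ℕ → ℝ≥0) : Measurable fun p : S × Ω => X (v (N p.1)) p.2 := by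
  have h : Measurable fun p : ℕ × Ω => X (v p.1) p.2 :=
    measurable_from_prod_countable_right fun n => hX (v n)
  exact h.comp ((hN.comp measurable_fst).prodMk measurable_snd)

/-- A process with almost surely right-continuous paths is jointly measurable up to a null
set. -/
lemma IsLevyProcess.aemeasurable_uncurry [SFinite P] {E : Type*} [NormedAddCommGroup E]
    [MeasurableSpace E] [BorelSpace E] {X : ℝ≥0 → Ω → E} {x : E} (hX : IsLevyProcess X x P)
    (μ : Measure ℝ) [SFinite μ] :
    AEMeasurable (fun p : ℝ × Ω => X p.1.toNNReal p.2) (μ.prod P) := by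
  -- The `+ 1` puts the grid point above `s`, at distance at most `1/(n+1)`, so right-continuity
  -- applies.
  set v : ℕ → ℝ → ℝ≥0 := fun n s =>
    ((⌊s.toNNReal * ((n + 1 : ℕ) : ℝ≥0)⌋₊ + 1 : ℕ) : ℝ≥0) / ((n + 1 : ℕ) : ℝ≥0) with hv
  have hle : ∀ n s, s.toNNReal ≤ v n s := by
    intro n s
    rw [hv, le_div_iff₀ (by positivity)]
    push_cast
    exact (Nat.lt_floor_add_one _).le
  have hub : ∀ n s, v n s ≤ s.toNNReal + 1 / ((n : ℝ≥0) + 1) := by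
    intro n s
    rw [hv]
    push_cast
    rw [add_div]
    gcongr
    rw [div_le_iff₀ (by positivity)]
    exact_mod_cast Nat.floor_le (zero_le (a := s.toNNReal * ((n + 1 : ℕ) : ℝ≥0)))
  have hlim : ∀ s, Tendsto (fun n => v n s) atTop (𝓝 s.toNNReal) := by
    intro s
    refine tendsto_of_tendsto_of_tendsto_of_le_of_le tendsto_const_nhds ?_
      (fun n => hle n s) (fun n => hub n s)
    simpa using tendsto_const_nhds.add (tendsto_one_div_add_atTop_nhds_zero_nat (𝕜 := ℝ≥0))
  refine aemeasurable_of_tendsto_metrizable_ae' (f := fun n p => X (v n p.1) p.2)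
    (fun n => ?_) ?_
  · refine (measurable_process_comp_grid hX.measurable
      (N := fun s : ℝ => ⌊s.toNNReal * ((n + 1 : ℕ) : ℝ≥0)⌋₊) ?_
      (fun k => ((k + 1 : ℕ) : ℝ≥0) / ((n + 1 : ℕ) : ℝ≥0))).aemeasurable
    exact Nat.measurable_floor.comp (by fun_prop)
  · filter_upwards [Measure.quasiMeasurePreserving_snd.ae hX.cadlag] with p hp
    exact (hp p.1.toNNReal).1.tendsto.comp
      (tendsto_nhdsWithin_iff.2 ⟨hlim p.1, Eventually.of_forall fun n => hle n p.1⟩)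

end JointMeasurability

/-! ### Mean square regularity of a Hölder function along the process -/

section HolderFunctional

variable {Ω : Type*} [MeasurableSpace Ω] {P : Measure Ω} {d : ℕ}

lemma IsLevyProcess.coord {X : ℝ≥0 → Ω → EuclideanSpace ℝ (Fin d)}
    {x : EuclideanSpace ℝ (Fin d)} (hX : IsLevyProcess X x P) (j : Fin d) :
    IsLevyProcess (fun s ω => X s ω j) (x j) P where
  measurable s := by
    have := hX.measurable s
    fun_prop
  start := by
    filter_upwards [hX.start] with ω hω
    rw [hω]
  indep_increments := hX.indep_increments.map (EuclideanSpace.proj (𝕜 := ℝ) j)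
  stationary_increments s u :=
    (hX.stationary_increments s u).comp (u := fun y : EuclideanSpace ℝ (Fin d) => y j)
      (by fun_prop)
  cadlag := by
    have hc : Continuous fun y : EuclideanSpace ℝ (Fin d) => y j := by fun_prop
    filter_upwards [hX.cadlag] with ω hω s
    obtain ⟨h1, l, hl⟩ := hω s
    exact ⟨hc.continuousAt.comp_continuousWithinAt h1, l j, (hc.tendsto l).comp hl⟩

lemma continuous_of_holder_coord {g : EuclideanSpace ℝ (Fin d) → ℝ} {L γ : ℝ} (hγ : 0 < γ)
    (hg : ∀ x y, |g x - g y| ≤ L * ∑ j, |x j - y j| ^ γ) : Continuous g := by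
  refine continuous_iff_continuousAt.2 fun x => ?_
  refine tendsto_iff_dist_tendsto_zero.2 (squeeze_zero (fun _ => dist_nonneg)
    (fun y => (Real.dist_eq _ _).trans_le (hg y x)) ?_)
  have hc : Continuous fun y : EuclideanSpace ℝ (Fin d) => L * ∑ j, |y j - x j| ^ γ := by
    refine continuous_const.mul (continuous_finsetSum _ fun j _ => ?_)
    exact Continuous.rpow_const (by fun_prop) fun _ => Or.inr hγ.le
  simpa [Real.zero_rpow hγ.ne'] using hc.tendsto x

/-- Mean square increments of a Hölder function along an isotropic stable process. -/
lemma IsIsotropicStableProcess.exists_lintegral_sq_increment_le [IsProbabilityMeasure P]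
    {β γ c L : ℝ}
    {X : ℝ≥0 → Ω → EuclideanSpace ℝ (Fin d)} {x : EuclideanSpace ℝ (Fin d)}
    (hX : IsIsotropicStableProcess β c X x P) (hβ : 0 < β) (hγ : 0 < γ) (hγβ : γ < β / 2)
    (hc : 0 < c) {g : EuclideanSpace ℝ (Fin d) → ℝ}
    (hg : ∀ x y, |g x - g y| ≤ L * ∑ j, |x j - y j| ^ γ) :
    ∃ K : ENNReal, K ≠ ⊤ ∧ ∀ s u : ℝ≥0,
      ∫⁻ ω, ‖g (X (s + u) ω) - g (X s ω)‖ₑ ^ 2 ∂P ≤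
        K * ENNReal.ofReal ((u : ℝ) ^ (2 * γ / β)) := by
  have hm := hX.levy.measurable
  -- The factor `d` comes from `(∑ a_j)² ≤ d ∑ a_j²`; the moments of order `2γ` are finite because
  -- `2γ < β`.
  refine ⟨ENNReal.ofReal (L ^ 2 * d) *
    ∑ j, ∫⁻ ω, ENNReal.ofReal (|X 1 ω j - X 0 ω j| ^ (2 * γ)) ∂P, ?_, fun s u => ?_⟩
  · refine ENNReal.mul_ne_top ENNReal.ofReal_ne_top (ENNReal.sum_ne_top.2 fun j _ => ?_)
    exact ((hX.levy.coord j).lintegral_abs_increment_one_rpow_lt_top hc.le (hX.coord_charFun j)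
      (by positivity) (by linarith)).ne
  · have hpt : ∀ ω, ‖g (X (s + u) ω) - g (X s ω)‖ₑ ^ 2 ≤ ENNReal.ofReal (L ^ 2 * d) *
        ∑ j, ENNReal.ofReal (|X (s + u) ω j - X s ω j| ^ (2 * γ)) := by
      intro ω
      rw [← ofReal_norm, Real.norm_eq_abs, ← ENNReal.ofReal_pow (abs_nonneg _),
        ← ENNReal.ofReal_sum_of_nonneg (fun j _ => by positivity),
        ← ENNReal.ofReal_mul (by positivity)]
      refine ENNReal.ofReal_le_ofReal ?_
      calc |g (X (s + u) ω) - g (X s ω)| ^ 2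
          ≤ (L * ∑ j, |X (s + u) ω j - X s ω j| ^ γ) ^ 2 := by
            gcongr
            exact hg _ _
        _ = L ^ 2 * (∑ j, |X (s + u) ω j - X s ω j| ^ γ) ^ 2 := by ring
        _ ≤ L ^ 2 * (d * ∑ j, (|X (s + u) ω j - X s ω j| ^ γ) ^ 2) := by
            gcongr
            simpa using sq_sum_le_card_mul_sum_sq (s := (Finset.univ : Finset (Fin d)))
              (f := fun j => |X (s + u) ω j - X s ω j| ^ γ)
        _ = L ^ 2 * d * ∑ j, |X (s + u) ω j - X s ω j| ^ (2 * γ) := by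
            rw [mul_assoc]
            congr 2
            refine Finset.sum_congr rfl fun j _ => ?_
            rw [mul_comm 2 γ, Real.rpow_mul (abs_nonneg _), Real.rpow_two]
    have hmj : ∀ (s : ℝ≥0) (j : Fin d), Measurable fun ω => X s ω j := fun s j =>
      (hX.levy.coord j).measurable s
    have hmeas : ∀ j, Measurable fun ω =>
        ENNReal.ofReal (|X (s + u) ω j - X s ω j| ^ (2 * γ)) := by
      intro j
      have := hmj (s + u) j
      have := hmj s j
      fun_prop
    refine (lintegral_mono hpt).trans_eq ?_
    rw [lintegral_const_mul _ (Finset.measurable_fun_sum _ fun j _ => hmeas j),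
      lintegral_finsetSum _ fun j _ => hmeas j, mul_assoc, Finset.sum_mul]
    congr 1
    refine Finset.sum_congr rfl fun j _ => ?_
    rw [(hX.levy.coord j).lintegral_abs_increment_rpow hβ (hX.coord_charFun j), mul_comm]

end HolderFunctional

/-! ### Pathwise error of the left Riemann sum -/

section RiemannSum

lemma sum_setLIntegral_Ico_le (f : ℝ → ENNReal) {h : ℝ} (hh : 0 ≤ h) (n : ℕ) :
    ∑ i ∈ Finset.range n, ∫⁻ s in Set.Ico (i * h) ((i + 1 : ℕ) * h), f s =
      ∫⁻ s in Set.Ico 0 (n * h), f s := by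
  induction n with
  | zero => simp
  | succ n ih =>
    have h1 : (0 : ℝ) ≤ n * h := by positivity
    have h2 : (n : ℝ) * h ≤ (n + 1 : ℕ) * h := by gcongr; simp
    rw [Finset.sum_range_succ, ih, ← Set.Ico_union_Ico_eq_Ico h1 h2,
      lintegral_union measurableSet_Ico]
    rw [Set.disjoint_left]
    exact fun s hs hs' => absurd hs.2 (not_lt.2 hs'.1)

/-- The error of the left Riemann sum of step `h`. -/
lemma enorm_integral_sub_riemannSum_le {f : ℝ → ℝ} {S h : ℝ} (hS : 0 ≤ S) (hh : 0 < h)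
    (hf : IntervalIntegrable f volume 0 S) :
    ‖(∫ s in (0 : ℝ)..S, f s) - ∑ i ∈ Finset.range ⌊S / h⌋₊, h * f (i * h)‖ₑ ≤
      (∫⁻ s in Set.Ico 0 S, ‖f s - f (⌊s / h⌋₊ * h)‖ₑ) +
        ∫⁻ s in Set.Ico (⌊S / h⌋₊ * h) S, ‖f s‖ₑ := by
  set m := ⌊S / h⌋₊ with hm
  have hmS : m * h ≤ S := by
    rw [← le_div_iff₀ hh]
    exact Nat.floor_le (by positivity)
  have hm0 : (0 : ℝ) ≤ m * h := by positivity
  have hsub : ∀ k < m, IntervalIntegrable f volume ((k : ℕ) * h) ((k + 1 : ℕ) * h) := by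
    intro k hk
    refine hf.mono_set ?_
    have h1 : (k : ℝ) * h ≤ (k + 1 : ℕ) * h := by gcongr; simp
    have h2 : ((k + 1 : ℕ) : ℝ) * h ≤ m * h := by gcongr; exact hk
    rw [Set.uIcc_of_le h1, Set.uIcc_of_le hS]
    exact Set.Icc_subset_Icc (by positivity) (h2.trans hmS)
  have hlast : IntervalIntegrable f volume (m * h) S := by
    refine hf.mono_set ?_
    rw [Set.uIcc_of_le hmS, Set.uIcc_of_le hS]
    exact Set.Icc_subset_Icc_left hm0
  have hfirst : IntervalIntegrable f volume 0 (m * h) := by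
    refine hf.mono_set ?_
    rw [Set.uIcc_of_le hm0, Set.uIcc_of_le hS]
    exact Set.Icc_subset_Icc_right hmS
  have hsplit : (∫ s in (0 : ℝ)..S, f s) - ∑ i ∈ Finset.range m, h * f (i * h) =
      (∑ i ∈ Finset.range m, ∫ s in ((i : ℕ) * h)..((i + 1 : ℕ) * h), (f s - f (i * h))) +
        ∫ s in (m * h)..S, f s := by
    rw [← intervalIntegral.integral_add_adjacent_intervals hfirst hlast]
    have h1 := intervalIntegral.sum_integral_adjacent_intervals (a := fun k : ℕ => (k : ℝ) * h)
      hsub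
    simp only [Nat.cast_zero, zero_mul] at h1
    rw [← h1, add_sub_right_comm, ← Finset.sum_sub_distrib]
    congr 1
    refine Finset.sum_congr rfl fun i hi => ?_
    rw [intervalIntegral.integral_sub (hsub i (Finset.mem_range.1 hi)) intervalIntegrable_const,
      intervalIntegral.integral_const, smul_eq_mul]
    push_cast
    ring
  rw [hsplit]
  refine (enorm_add_le _ _).trans (add_le_add ?_ ?_)
  · have hterm : ∀ i : ℕ, ‖∫ s in ((i : ℕ) * h)..((i + 1 : ℕ) * h), (f s - f (i * h))‖ₑ ≤
        ∫⁻ s in Set.Ico (i * h) ((i + 1 : ℕ) * h), ‖f s - f (⌊s / h⌋₊ * h)‖ₑ := by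
      intro i
      have h1 : (i : ℝ) * h ≤ (i + 1 : ℕ) * h := by gcongr; simp
      -- Cells closed on the left are needed so that `⌊s/h⌋₊ = i` throughout; the floor jumps at the
      -- right endpoint.
      rw [intervalIntegral.integral_of_le h1, ← integral_Ico_eq_integral_Ioc]
      refine (enorm_integral_le_lintegral_enorm _).trans
        (setLIntegral_mono' measurableSet_Ico fun s hs => ?_)
      have : ⌊s / h⌋₊ = i := by
        rw [Nat.floor_eq_iff (div_nonneg (le_trans (by positivity) hs.1) hh.le),
          le_div_iff₀ hh, div_lt_iff₀ hh]
        exact ⟨hs.1, by simpa using hs.2⟩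
      rw [this]
    calc _ ≤ ∑ i ∈ Finset.range m,
          ‖∫ s in ((i : ℕ) * h)..((i + 1 : ℕ) * h), (f s - f (i * h))‖ₑ := enorm_sum_le _ _
      _ ≤ ∑ i ∈ Finset.range m, ∫⁻ s in Set.Ico (i * h) ((i + 1 : ℕ) * h),
            ‖f s - f (⌊s / h⌋₊ * h)‖ₑ := Finset.sum_le_sum fun i _ => hterm i
      _ = ∫⁻ s in Set.Ico 0 (m * h), ‖f s - f (⌊s / h⌋₊ * h)‖ₑ :=
          sum_setLIntegral_Ico_le _ hh.le m
      _ ≤ _ := lintegral_mono_set (Set.Ico_subset_Ico_right hmS)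
  · rw [intervalIntegral.integral_of_le hmS, ← integral_Ico_eq_integral_Ioc]
    exact enorm_integral_le_lintegral_enorm _

lemma ennreal_add_sq_le {a b : ENNReal} : (a + b) ^ 2 ≤ 2 * (a ^ 2 + b ^ 2) := by
  have := ENNReal.rpow_add_le_mul_rpow_add_rpow a b one_le_two
  norm_num at this
  exact this

/-- Cauchy-Schwarz on an interval. -/
lemma sq_setLIntegral_Ico_le {f : ℝ → ENNReal} {a b : ℝ}
    (hf : AEMeasurable f (volume.restrict (Set.Ico a b))) :
    (∫⁻ s in Set.Ico a b, f s) ^ 2 ≤ ENNReal.ofReal (b - a) * ∫⁻ s in Set.Ico a b, f s ^ 2 := by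
  have h := ENNReal.lintegral_mul_le_Lp_mul_Lq (volume.restrict (Set.Ico a b))
    Real.HolderConjugate.two_two (aemeasurable_const (b := (1 : ENNReal))) hf
  simp only [Pi.mul_apply, one_mul, ENNReal.rpow_two, one_pow, lintegral_one,
    Measure.restrict_apply_univ, Real.volume_Ico] at h
  calc _ ≤ _ := pow_le_pow_left₀ zero_le h 2
    _ = _ := by
      rw [mul_pow, ← ENNReal.rpow_natCast, ← ENNReal.rpow_natCast, ← ENNReal.rpow_mul,
        ← ENNReal.rpow_mul]
      norm_num

end RiemannSum

/-! ### Mean square error up to an independent random time -/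

section IndependentTime

variable {Ω : Type*} [MeasurableSpace Ω] {P : Measure Ω} [IsProbabilityMeasure P]

/-- Integrating a weight that depends on an independent time against a process. -/
lemma lintegral_lintegral_mul_le_of_indepFun {T : Ω → ℝ≥0} (hT : Measurable T)
    {W : ℝ → ℝ≥0 → ENNReal} (hW : Measurable (Function.uncurry W)) {Q : ℝ → Ω → ENNReal}
    (hQ : AEMeasurable (Function.uncurry Q) (volume.prod P)) (hQs : ∀ s, Measurable (Q s))
    (hind : ∀ s, IndepFun (Q s) T P) {q : ℝ → ENNReal} (hq : Measurable q)
    (hQq : ∀ s, ∫⁻ ω, Q s ω ∂P ≤ q s) :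
    ∫⁻ ω, (∫⁻ s, W s (T ω) * Q s ω) ∂P ≤ ∫⁻ ω, (∫⁻ s, W s (T ω) * q s) ∂P := by
  have hWT : Measurable fun p : ℝ × Ω => W p.1 (T p.2) :=
    hW.comp (measurable_fst.prodMk (hT.comp measurable_snd))
  have hWs : ∀ s, Measurable (W s) := fun s => hW.comp measurable_prodMk_left
  rw [← lintegral_lintegral_swap (f := fun s ω => W s (T ω) * Q s ω)
      (hWT.aemeasurable.mul hQ),
    ← lintegral_lintegral_swap (f := fun s ω => W s (T ω) * q s)
      (hWT.mul (hq.comp measurable_fst)).aemeasurable]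
  -- After Tonelli, `s` is fixed and the expectation factors by independence of `Q s` and `T`.
  refine lintegral_mono fun s => ?_
  have h1 := lintegral_mul_eq_lintegral_mul_lintegral_of_indepFun ((hWs s).comp hT) (hQs s)
    ((hind s).symm.comp (hWs s) measurable_id)
  rw [lintegral_mul_const (f := fun ω => W s (T ω)) _ ((hWs s).comp hT)]
  exact Eq.trans_le h1 (mul_le_mul' le_rfl (hQq s))

variable {G : ℝ≥0 → Ω → ℝ} {T : Ω → ℝ≥0} {K : ENNReal} {θ : ℝ}

/-- Split `G s` as `G 0` plus an increment. The bound serves for local integrability and for the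
last incomplete cell. -/
lemma lintegral_enorm_sq_le_of_increment {P : Measure Ω} (hGm : ∀ s, Measurable (G s))
    (hK : ∀ s u : ℝ≥0, ∫⁻ ω, ‖G (s + u) ω - G s ω‖ₑ ^ 2 ∂P ≤ K * ENNReal.ofReal ((u : ℝ) ^ θ))
    (s : ℝ≥0) :
    ∫⁻ ω, ‖G s ω‖ₑ ^ 2 ∂P ≤
      2 * (∫⁻ ω, ‖G 0 ω‖ₑ ^ 2 ∂P + K * ENNReal.ofReal ((s : ℝ) ^ θ)) := by
  have hs := hGm s
  have h0 := hGm 0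
  have hs' := hGm (0 + s)
  have hpt : ∀ ω, ‖G s ω‖ₑ ^ 2 ≤ 2 * (‖G 0 ω‖ₑ ^ 2 + ‖G (0 + s) ω - G 0 ω‖ₑ ^ 2) := by
    intro ω
    rw [zero_add]
    calc ‖G s ω‖ₑ ^ 2 = ‖G 0 ω + (G s ω - G 0 ω)‖ₑ ^ 2 := by rw [add_sub_cancel]
      _ ≤ (‖G 0 ω‖ₑ + ‖G s ω - G 0 ω‖ₑ) ^ 2 := by gcongr; exact enorm_add_le _ _
      _ ≤ _ := ennreal_add_sq_le
  refine (lintegral_mono hpt).trans ?_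
  have h2 : Measurable fun ω => ‖G 0 ω‖ₑ ^ 2 := by fun_prop
  have h3 : Measurable fun ω => ‖G (0 + s) ω - G 0 ω‖ₑ ^ 2 := by
    rw [zero_add]
    fun_prop
  rw [lintegral_const_mul _ (by fun_prop), lintegral_add_left h2]
  gcongr
  exact hK 0 s

/-- Almost every path is locally integrable on `[0, ∞)`. -/
lemma ae_intervalIntegrable_path (hG : AEMeasurable (fun p : ℝ × Ω => G p.1.toNNReal p.2)
      (volume.prod P)) (hGm : ∀ s, Measurable (G s)) (hθ : 0 ≤ θ) (hKtop : K ≠ ⊤)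
    (hK : ∀ s u : ℝ≥0, ∫⁻ ω, ‖G (s + u) ω - G s ω‖ₑ ^ 2 ∂P ≤ K * ENNReal.ofReal ((u : ℝ) ^ θ))
    (h0 : ∫⁻ ω, ‖G 0 ω‖ₑ ^ 2 ∂P ≠ ⊤) :
    ∀ᵐ ω ∂P, ∀ S : ℝ, 0 ≤ S →
      IntervalIntegrable (fun s => G s.toNNReal ω) volume 0 S := by
  have hG' : AEMeasurable (fun p : Ω × ℝ => G p.2.toNNReal p.1) (P.prod volume) := hG.prod_swap
  -- Integer horizons leave one null set valid for all `S`, as needed to insert the random `T`.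
  have hfin : ∀ n : ℕ, ∀ᵐ ω ∂P, ∫⁻ s in Set.Ioc (0 : ℝ) n, ‖G s.toNNReal ω‖ₑ < ⊤ := by
    intro n
    have hres : AEMeasurable (fun p : Ω × ℝ => ‖G p.2.toNNReal p.1‖ₑ)
        (P.prod (volume.restrict (Set.Ioc (0 : ℝ) n))) := by
      refine hG'.enorm.mono_ac ?_
      exact Measure.AbsolutelyContinuous.rfl.prod Measure.restrict_le_self.absolutelyContinuous
    refine ae_lt_top' hres.lintegral_prod_right' (ne_of_lt ?_)
    rw [lintegral_lintegral_swap hres]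
    have hbound : ∀ s ∈ Set.Ioc (0 : ℝ) n, ∫⁻ ω, ‖G s.toNNReal ω‖ₑ ∂P ≤
        1 + 2 * (∫⁻ ω, ‖G 0 ω‖ₑ ^ 2 ∂P + K * ENNReal.ofReal ((n : ℝ) ^ θ)) := by
      intro s hs
      have hpt : ∀ ω, ‖G s.toNNReal ω‖ₑ ≤ 1 + ‖G s.toNNReal ω‖ₑ ^ 2 := by
        intro ω
        rcases le_total ‖G s.toNNReal ω‖ₑ 1 with hle | hle
        · exact hle.trans le_self_add
        · exact (le_self_pow hle two_ne_zero).trans le_add_self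
      refine (lintegral_mono hpt).trans ?_
      rw [lintegral_add_left measurable_const, lintegral_one, measure_univ]
      gcongr
      refine (lintegral_enorm_sq_le_of_increment hGm hK _).trans ?_
      gcongr
      rw [Real.coe_toNNReal _ hs.1.le]
      exact hs.2
    refine (setLIntegral_mono' measurableSet_Ioc hbound).trans_lt ?_
    rw [setLIntegral_const]
    refine ENNReal.mul_lt_top ?_ (by simp)
    have : K * ENNReal.ofReal ((n : ℝ) ^ θ) ≠ ⊤ := ENNReal.mul_ne_top hKtop ENNReal.ofReal_ne_top
    finiteness
  have hsec : ∀ᵐ ω ∂P, AEStronglyMeasurable (fun s : ℝ => G s.toNNReal ω) volume :=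
    hG'.aestronglyMeasurable.prodMk_left
  filter_upwards [ae_all_iff.2 hfin, hsec] with ω hω hm S hS
  obtain ⟨n, hn⟩ := exists_nat_ge S
  rw [intervalIntegrable_iff_integrableOn_Ioc_of_le hS]
  refine ⟨hm.restrict, ?_⟩
  exact (lintegral_mono_set (Set.Ioc_subset_Ioc_right hn)).trans_lt (hω n)

/-- The difference between the time integral of a process up to a random time and its left
Riemann sum is measurable. -/
lemma aestronglyMeasurable_integral_sub_riemannSum
    (hG : AEMeasurable (fun p : ℝ × Ω => G p.1.toNNReal p.2) (volume.prod P))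
    (hGm : ∀ s, Measurable (G s)) (hT : Measurable T) (h : ℝ) :
    AEStronglyMeasurable (fun ω => (∫ s in (0 : ℝ)..(T ω : ℝ), G s.toNNReal ω) -
      ∑ i ∈ Finset.range ⌊(T ω : ℝ) / h⌋₊, h * G (Real.toNNReal (i * h)) ω) P := by
  refine AEStronglyMeasurable.sub ?_ (Measurable.aestronglyMeasurable ?_)
  · have hset : MeasurableSet {p : Ω × ℝ | 0 < p.2 ∧ p.2 ≤ (T p.1 : ℝ)} :=
      (measurableSet_lt measurable_const measurable_snd).inter
        (measurableSet_le measurable_snd (by fun_prop))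
    have h1 := (hG.prod_swap.aestronglyMeasurable.indicator hset).integral_prod_right'
    refine h1.congr (Eventually.of_forall fun ω => ?_)
    simp only
    rw [intervalIntegral.integral_of_le (T ω).coe_nonneg, ← integral_indicator measurableSet_Ioc]
    rfl
  · have h1 : Measurable fun p : ℕ × Ω =>
        ∑ i ∈ Finset.range p.1, h * G (Real.toNNReal (i * h)) p.2 :=
      measurable_from_prod_countable_right fun n => by
        have hi : ∀ i : ℕ, Measurable fun ω => h * G (Real.toNNReal (i * h)) ω := fun i =>
          (hGm _).const_mul h
        exact Finset.measurable_fun_sum (Finset.range n) fun i _ => hi i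
    have hfloor : Measurable fun ω => ⌊(T ω : ℝ) / h⌋₊ :=
      Nat.measurable_floor.comp (by fun_prop)
    exact h1.comp (hfloor.prodMk measurable_id)

/-- The weighted second moment of the part of the time integral beyond the last grid point. -/
lemma lintegral_remainder_weight_le {h : ℝ} (hh : 0 < h) (hθ : 0 ≤ θ) (hθ2 : θ ≤ 2)
    (A K : ENNReal) (S : ℝ≥0) :
    ∫⁻ s in Set.Ico (⌊(S : ℝ) / h⌋₊ * h) (S : ℝ),
        ENNReal.ofReal (S - ⌊(S : ℝ) / h⌋₊ * h) *
          (2 * (A + K * ENNReal.ofReal ((s.toNNReal : ℝ) ^ θ))) ≤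
      2 * (A * (1 + (S : ENNReal) ^ 2) + K * (S : ENNReal) ^ 2) * ENNReal.ofReal (h ^ θ) := by
  set r : ℝ := S - ⌊(S : ℝ) / h⌋₊ * h with hr
  have hfl : (⌊(S : ℝ) / h⌋₊ : ℝ) * h ≤ S := by
    rw [← le_div_iff₀ hh]
    exact Nat.floor_le (by positivity)
  have hr0 : 0 ≤ r := by linarith
  have hrS : r ≤ S := by
    have : (0 : ℝ) ≤ ⌊(S : ℝ) / h⌋₊ * h := by positivity
    linarith
  have hrh : r ≤ h := by
    have := Nat.lt_floor_add_one ((S : ℝ) / h)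
    rw [div_lt_iff₀ hh] at this
    linarith
  -- One factor `r` is the weight, the other the length of the cell; `r ≤ h` is spent on exponent
  -- `θ`, `r ≤ S` on `2 - θ`.
  have hr2 : r ^ 2 ≤ h ^ θ * (S : ℝ) ^ (2 - θ) := by
    calc r ^ 2 = r ^ (θ + (2 - θ)) := by rw [add_sub_cancel, Real.rpow_two]
      _ = r ^ θ * r ^ (2 - θ) := Real.rpow_add_of_nonneg hr0 hθ (by linarith)
      _ ≤ _ := by
        gcongr
  have hSle : (S : ℝ) ^ (2 - θ) ≤ 1 + (S : ℝ) ^ 2 := by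
    rcases le_total (S : ℝ) 1 with h1 | h1
    · have := Real.rpow_le_one S.coe_nonneg h1 (show 0 ≤ 2 - θ by linarith)
      nlinarith [sq_nonneg (S : ℝ)]
    · have := Real.rpow_le_rpow_of_exponent_le h1 (show 2 - θ ≤ 2 by linarith)
      rw [Real.rpow_two] at this
      linarith
  have hSS : (S : ℝ) ^ (2 - θ) * (S : ℝ) ^ θ = (S : ℝ) ^ 2 := by
    rw [← Real.rpow_add_of_nonneg S.coe_nonneg (by linarith) hθ, sub_add_cancel, Real.rpow_two]
  have hsq : ENNReal.ofReal ((S : ℝ) ^ 2) = (S : ENNReal) ^ 2 := by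
    rw [ENNReal.ofReal_pow S.coe_nonneg, ENNReal.ofReal_coe_nnreal]
  calc _ ≤ ∫⁻ s in Set.Ico (⌊(S : ℝ) / h⌋₊ * h) (S : ℝ), ENNReal.ofReal r *
          (2 * (A + K * ENNReal.ofReal ((S : ℝ) ^ θ))) := by
        refine setLIntegral_mono' measurableSet_Ico fun s hs => ?_
        gcongr
        exact Real.toNNReal_le_iff_le_coe.2 hs.2.le
    _ = 2 * (A * ENNReal.ofReal (r ^ 2) + K * ENNReal.ofReal (r ^ 2 * (S : ℝ) ^ θ)) := by
        rw [setLIntegral_const, Real.volume_Ico, ← hr, ENNReal.ofReal_mul (sq_nonneg r),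
          ENNReal.ofReal_pow hr0]
        ring
    _ ≤ 2 * (A * ENNReal.ofReal (h ^ θ * (1 + (S : ℝ) ^ 2)) +
          K * ENNReal.ofReal (h ^ θ * (S : ℝ) ^ 2)) := by
        refine mul_le_mul' le_rfl (add_le_add
          (mul_le_mul' le_rfl (ENNReal.ofReal_le_ofReal ?_))
          (mul_le_mul' le_rfl (ENNReal.ofReal_le_ofReal ?_)))
        · exact hr2.trans (by gcongr)
        · calc r ^ 2 * (S : ℝ) ^ θ ≤ h ^ θ * (S : ℝ) ^ (2 - θ) * (S : ℝ) ^ θ := by gcongr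
            _ = h ^ θ * (S : ℝ) ^ 2 := by rw [mul_assoc, hSS]
    _ = _ := by
        rw [ENNReal.ofReal_mul (by positivity), ENNReal.ofReal_mul (by positivity),
          ENNReal.ofReal_add zero_le_one (by positivity), hsq, ENNReal.ofReal_one]
        ring

/-- Mean square error of the left Riemann sum of a process up to an independent random time. -/
lemma lintegral_sq_integral_sub_riemannSum_le
    (hG : AEMeasurable (fun p : ℝ × Ω => G p.1.toNNReal p.2) (volume.prod P))
    (hGm : ∀ s, Measurable (G s)) (hT : Measurable T)
    (hind : ∀ s u, IndepFun (fun ω => (G s ω, G u ω)) T P)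
    (hθ : 0 ≤ θ) (hθ2 : θ ≤ 2) (hKtop : K ≠ ⊤)
    (hK : ∀ s u : ℝ≥0, ∫⁻ ω, ‖G (s + u) ω - G s ω‖ₑ ^ 2 ∂P ≤ K * ENNReal.ofReal ((u : ℝ) ^ θ))
    (h0 : ∫⁻ ω, ‖G 0 ω‖ₑ ^ 2 ∂P ≠ ⊤) {h : ℝ} (hh : 0 < h) :
    ∫⁻ ω, ‖(∫ s in (0 : ℝ)..(T ω : ℝ), G s.toNNReal ω) -
      ∑ i ∈ Finset.range ⌊(T ω : ℝ) / h⌋₊, h * G (Real.toNNReal (i * h)) ω‖ₑ ^ 2 ∂P ≤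
      2 * (K * ∫⁻ ω, (T ω : ENNReal) ^ 2 ∂P +
        2 * ((∫⁻ ω, ‖G 0 ω‖ₑ ^ 2 ∂P) * (1 + ∫⁻ ω, (T ω : ENNReal) ^ 2 ∂P) +
          K * ∫⁻ ω, (T ω : ENNReal) ^ 2 ∂P)) * ENNReal.ofReal (h ^ θ) := by
  set A := ∫⁻ ω, ‖G 0 ω‖ₑ ^ 2 ∂P with hA
  set D : ℝ → Ω → ℝ := fun s ω => G s.toNNReal ω - G (⌊s / h⌋₊ * h : ℝ).toNNReal ω with hD
  -- `W₁` and `W₂` combine the Cauchy-Schwarz length factor with the indicator of the random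
  -- interval, so that the integrals run over all of `ℝ` and Tonelli applies.
  set W₁ : ℝ → ℝ≥0 → ENNReal := fun s S =>
    {p : ℝ × ℝ≥0 | 0 ≤ p.1 ∧ p.1 < p.2}.indicator (fun p => (p.2 : ENNReal)) (s, S) with hW₁
  set W₂ : ℝ → ℝ≥0 → ENNReal := fun s S =>
    {p : ℝ × ℝ≥0 | ⌊(p.2 : ℝ) / h⌋₊ * h ≤ p.1 ∧ p.1 < p.2}.indicator
      (fun p => ENNReal.ofReal (p.2 - ⌊(p.2 : ℝ) / h⌋₊ * h)) (s, S) with hW₂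
  have hgrid : Measurable fun p : ℝ × Ω => G (⌊p.1 / h⌋₊ * h : ℝ).toNNReal p.2 :=
    measurable_process_comp_grid hGm (N := fun s : ℝ => ⌊s / h⌋₊)
      (Nat.measurable_floor.comp (by fun_prop)) fun k => (k * h : ℝ).toNNReal
  have hDjoint : AEMeasurable (Function.uncurry D) (volume.prod P) := hG.sub hgrid.aemeasurable
  have hDs : ∀ s, Measurable (D s) := fun s => (hGm _).sub (hGm _)
  have hW₁m : Measurable (Function.uncurry W₁) := by
    refine Measurable.indicator (by fun_prop) ?_
    exact (measurableSet_le measurable_const measurable_fst).inter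
      (measurableSet_lt measurable_fst (by fun_prop))
  have hflm : Measurable fun p : ℝ × ℝ≥0 => (⌊(p.2 : ℝ) / h⌋₊ : ℝ) :=
    measurable_from_nat.comp (Nat.measurable_floor.comp (by fun_prop))
  have hW₂m : Measurable (Function.uncurry W₂) := by
    refine Measurable.indicator (by fun_prop) ?_
    exact (measurableSet_le (by fun_prop) measurable_fst).inter
      (measurableSet_lt measurable_fst (by fun_prop))
  have hW₁int : ∀ (f : ℝ → ENNReal) (S : ℝ≥0), ∫⁻ s, W₁ s S * f s =
      ∫⁻ s in Set.Ico 0 (S : ℝ), S * f s := by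
    intro f S
    rw [← lintegral_indicator measurableSet_Ico]
    refine lintegral_congr fun s => ?_
    simp only [hW₁, Set.indicator_apply, Set.mem_ofPred_eq, Set.mem_Ico]
    split_ifs <;> simp
  have hW₂int : ∀ (f : ℝ → ENNReal) (S : ℝ≥0), ∫⁻ s, W₂ s S * f s =
      ∫⁻ s in Set.Ico (⌊(S : ℝ) / h⌋₊ * h) (S : ℝ),
        ENNReal.ofReal (S - ⌊(S : ℝ) / h⌋₊ * h) * f s := by
    intro f S
    rw [← lintegral_indicator measurableSet_Ico]
    refine lintegral_congr fun s => ?_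
    simp only [hW₂, Set.indicator_apply, Set.mem_ofPred_eq, Set.mem_Ico]
    split_ifs <;> simp
  -- Negative `s` is harmless: `⌊s/h⌋₊` and `s.toNNReal` both vanish, so `D s = 0`.
  have hDq : ∀ s, ∫⁻ ω, ‖D s ω‖ₑ ^ 2 ∂P ≤ K * ENNReal.ofReal (h ^ θ) := by
    intro s
    set k : ℝ≥0 := (⌊s / h⌋₊ * h : ℝ).toNNReal with hk
    have hkR : (k : ℝ) = ⌊s / h⌋₊ * h := Real.coe_toNNReal _ (by positivity)
    have hks : k ≤ s.toNNReal := by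
      rw [← NNReal.coe_le_coe, hkR, Real.coe_toNNReal']
      rcases le_total 0 s with hs | hs
      · refine le_max_of_le_left ?_
        rw [← le_div_iff₀ hh]
        exact Nat.floor_le (by positivity)
      · rw [Nat.floor_of_nonpos (div_nonpos_of_nonpos_of_nonneg hs hh.le)]
        simp
    have hsk : (s.toNNReal - k : ℝ≥0) ≤ h := by
      rw [NNReal.coe_sub hks, hkR, Real.coe_toNNReal']
      have h1 := Nat.lt_floor_add_one (s / h)
      rw [div_lt_iff₀ hh] at h1
      have h2 : (0 : ℝ) ≤ ⌊s / h⌋₊ * h := by positivity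
      rcases le_total 0 s with hs | hs
      · rw [max_eq_left hs]
        linarith
      · rw [max_eq_right hs]
        linarith
    have := hK k (s.toNNReal - k)
    rw [add_tsub_cancel_of_le hks] at this
    refine this.trans ?_
    gcongr
  have step₁ : ∫⁻ ω, (∫⁻ s, W₁ s (T ω) * ‖D s ω‖ₑ ^ 2) ∂P ≤
      K * (∫⁻ ω, (T ω : ENNReal) ^ 2 ∂P) * ENNReal.ofReal (h ^ θ) := by
    refine (lintegral_lintegral_mul_le_of_indepFun hT hW₁m (hDjoint.enorm.pow_const 2)
      (fun s => (hDs s).enorm.pow_const 2)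
      (fun s => (hind _ _).comp (φ := fun p : ℝ × ℝ => ‖p.1 - p.2‖ₑ ^ 2) (by fun_prop)
        measurable_id) (measurable_const (a := K * ENNReal.ofReal (h ^ θ))) hDq).trans_eq ?_
    simp_rw [hW₁int, setLIntegral_const, Real.volume_Ico, sub_zero, ENNReal.ofReal_coe_nnreal]
    rw [mul_right_comm, ← lintegral_const_mul _ (by fun_prop)]
    refine lintegral_congr fun ω => ?_
    ring
  have step₂ : ∫⁻ ω, (∫⁻ s, W₂ s (T ω) * ‖G s.toNNReal ω‖ₑ ^ 2) ∂P ≤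
      2 * (A * (1 + ∫⁻ ω, (T ω : ENNReal) ^ 2 ∂P) + K * ∫⁻ ω, (T ω : ENNReal) ^ 2 ∂P) *
        ENNReal.ofReal (h ^ θ) := by
    refine (lintegral_lintegral_mul_le_of_indepFun hT hW₂m (hG.enorm.pow_const 2)
      (fun s => (hGm _).enorm.pow_const 2)
      (fun s => (hind _ s.toNNReal).comp (φ := fun p : ℝ × ℝ => ‖p.1‖ₑ ^ 2) (by fun_prop)
        measurable_id)
      (q := fun s : ℝ => 2 * (A + K * ENNReal.ofReal ((s.toNNReal : ℝ) ^ θ))) (by fun_prop)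
      (fun s => lintegral_enorm_sq_le_of_increment hGm hK _)).trans ?_
    simp_rw [hW₂int]
    refine (lintegral_mono fun ω => lintegral_remainder_weight_le hh hθ hθ2 A K (T ω)).trans_eq ?_
    have hT2 : Measurable fun ω => (T ω : ENNReal) ^ 2 := by fun_prop
    rw [lintegral_mul_const _ (by fun_prop), lintegral_const_mul _ (by fun_prop),
      lintegral_add_left (by fun_prop), lintegral_const_mul _ (by fun_prop),
      lintegral_const_mul _ hT2, lintegral_add_left measurable_const, lintegral_one, measure_univ]
  have hsecD : ∀ᵐ ω ∂P, AEMeasurable (fun s => ‖D s ω‖ₑ) volume :=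
    (hDjoint.enorm.prod_swap.aestronglyMeasurable.prodMk_left).mono fun ω hω => hω.aemeasurable
  have hsecG : ∀ᵐ ω ∂P, AEMeasurable (fun s : ℝ => ‖G s.toNNReal ω‖ₑ) volume :=
    (hG.enorm.prod_swap.aestronglyMeasurable.prodMk_left).mono fun ω hω => hω.aemeasurable
  have hpt : ∀ᵐ ω ∂P, ‖(∫ s in (0 : ℝ)..(T ω : ℝ), G s.toNNReal ω) -
      ∑ i ∈ Finset.range ⌊(T ω : ℝ) / h⌋₊, h * G (Real.toNNReal (i * h)) ω‖ₑ ^ 2 ≤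
      2 * ((∫⁻ s, W₁ s (T ω) * ‖D s ω‖ₑ ^ 2) +
        ∫⁻ s, W₂ s (T ω) * ‖G s.toNNReal ω‖ₑ ^ 2) := by
    filter_upwards [ae_intervalIntegrable_path hG hGm hθ hKtop hK h0, hsecD, hsecG]
      with ω hω hωD hωG
    refine (pow_le_pow_left₀ zero_le (enorm_integral_sub_riemannSum_le (T ω).coe_nonneg hh
      (hω _ (T ω).coe_nonneg)) 2).trans (ennreal_add_sq_le.trans ?_)
    rw [hW₁int, hW₂int, lintegral_const_mul'' _ (hωD.restrict.pow_const 2),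
      lintegral_const_mul'' _ (hωG.restrict.pow_const 2)]
    gcongr
    · simpa using sq_setLIntegral_Ico_le (a := 0) (b := T ω) hωD.restrict
    · exact sq_setLIntegral_Ico_le hωG.restrict
  refine (lintegral_mono_ae hpt).trans ?_
  have hm₁ : AEMeasurable (fun ω => ∫⁻ s, W₁ s (T ω) * ‖D s ω‖ₑ ^ 2) P := by
    refine AEMeasurable.lintegral_prod_right' (f := fun p : Ω × ℝ =>
      W₁ p.2 (T p.1) * ‖D p.2 p.1‖ₑ ^ 2) ?_
    exact (hW₁m.comp (measurable_snd.prodMk (hT.comp measurable_fst))).aemeasurable.mul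
      (hDjoint.prod_swap.enorm.pow_const 2)
  rw [lintegral_const_mul' _ _ (by simp), lintegral_add_left' hm₁, mul_assoc]
  gcongr
  refine (add_le_add step₁ step₂).trans_eq ?_
  ring

end IndependentTime

/-! ### Assembly of the estimate -/

lemma exactFunctional_sub_discretizedFunctional {Ω E : Type*} (φ g : E → ℝ)
    (X : ℝ≥0 → Ω → E) (T : Ω → ℝ≥0) (h : ℝ) (ω : Ω) :
    exactFunctional φ g X T ω - discretizedFunctional φ g X T h ω =
      (∫ s in (0 : ℝ)..(T ω : ℝ), g (X s.toNNReal ω)) -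
        ∑ i ∈ Finset.range ⌊(T ω : ℝ) / h⌋₊, h * g (X (Real.toNNReal (i * h)) ω) :=
  add_sub_add_left_eq_sub _ _ _

variable {Ω : Type*} [MeasurableSpace Ω] {P : Measure Ω}

lemma memLp_two_and_integral_sq_le {D : Ω → ℝ} (hD : AEStronglyMeasurable D P) {C : ENNReal}
    (hC : C ≠ ⊤) {b : ℝ} (hb : 0 ≤ b)
    (hle : ∫⁻ ω, ‖D ω‖ₑ ^ 2 ∂P ≤ C * ENNReal.ofReal b) :
    MemLp D 2 P ∧ ∫ ω, |D ω| ^ 2 ∂P ≤ C.toReal * b := by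
  have hfin : C * ENNReal.ofReal b ≠ ⊤ := ENNReal.mul_ne_top hC ENNReal.ofReal_ne_top
  have hsq : ∀ ω, ‖|D ω| ^ 2‖ₑ = ‖D ω‖ₑ ^ 2 := fun ω => by
    rw [enorm_pow, ← Real.norm_eq_abs, enorm_norm]
  refine ⟨?_, ?_⟩
  · rw [memLp_two_iff_integrable_sq hD]
    refine ⟨hD.pow 2, ?_⟩
    rw [HasFiniteIntegral]
    simp_rw [enorm_pow]
    exact hle.trans_lt hfin.lt_top
  · rw [integral_eq_lintegral_of_nonneg_ae (Eventually.of_forall fun ω => sq_nonneg _)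
      (f := fun ω => |D ω| ^ 2) (hD.norm.pow 2), ← ENNReal.toReal_ofReal hb, ← ENNReal.toReal_mul]
    refine ENNReal.toReal_mono hfin (le_trans (le_of_eq ?_) hle)
    refine lintegral_congr fun ω => ?_
    rw [← hsq ω, Real.enorm_of_nonneg (by positivity)]

lemma exists_bound_sq_discretization_error [IsProbabilityMeasure P] {d : ℕ}
    {α β γ c L a t : ℝ} (hα : 0 < α) (hα1 : α < 1) (hβ : 0 < β) (hγ : 0 < γ) (hγβ : γ < β / 2)
    (hc : 0 < c) {τ : ℝ≥0 → Ω → ℝ} (hτ : IsStableSubordinator α τ P)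
    {X : ℝ≥0 → Ω → EuclideanSpace ℝ (Fin d)} {x : EuclideanSpace ℝ (Fin d)}
    (hX : IsIsotropicStableProcess β c X x P)
    (hXτ : IndepFun (fun ω s => X s ω) (fun ω s => τ s ω) P)
    (φ : EuclideanSpace ℝ (Fin d) → ℝ) {g : EuclideanSpace ℝ (Fin d) → ℝ}
    (hg : ∀ x y, |g x - g y| ≤ L * ∑ j, |x j - y j| ^ γ) (hat : a < t) :
    ∃ M : ℝ, ∀ h : ℝ, 0 < h →
      MemLp (fun ω => exactFunctional φ g X (exitTime τ a t) ω -
        discretizedFunctional φ g X (exitTime τ a t) h ω) 2 P ∧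
      ∫ ω, |exactFunctional φ g X (exitTime τ a t) ω -
        discretizedFunctional φ g X (exitTime τ a t) h ω| ^ 2 ∂P ≤ M * h ^ (2 * γ / β) := by
  have hgm : Measurable g := (continuous_of_holder_coord hγ hg).measurable
  have hθ1 : 2 * γ / β ≤ 2 := by
    rw [div_le_iff₀ hβ]
    linarith
  obtain ⟨K, hKtop, hK⟩ := hX.exists_lintegral_sq_increment_le hβ hγ hγβ hc hg
  obtain ⟨F, hF, hTF⟩ := exists_measurable_exitTime hτ.monotone a t
  -- As a measurable function of the path of `τ`, this version of the exit time is measurable and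
  -- inherits independence from `X`.
  set T : Ω → ℝ≥0 := fun ω => F fun s => τ s ω with hTdef
  have hT : Measurable T := hF.comp (measurable_pi_lambda _ hτ.levy.measurable)
  have hGm : ∀ s, Measurable fun ω => g (X s ω) := fun s => hgm.comp (hX.levy.measurable s)
  have hG : AEMeasurable (fun p : ℝ × Ω => g (X p.1.toNNReal p.2)) (volume.prod P) :=
    hgm.comp_aemeasurable (hX.levy.aemeasurable_uncurry volume)
  have hind : ∀ s u, IndepFun (fun ω => (g (X s ω), g (X u ω))) T P := fun s u =>
    hXτ.comp (φ := fun p : ℝ≥0 → EuclideanSpace ℝ (Fin d) => (g (p s), g (p u)))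
      ((hgm.comp (measurable_pi_apply s)).prodMk (hgm.comp (measurable_pi_apply u))) hF
  have h0 : ∫⁻ ω, ‖g (X 0 ω)‖ₑ ^ 2 ∂P ≠ ⊤ := by
    have : ∫⁻ ω, ‖g (X 0 ω)‖ₑ ^ 2 ∂P = ∫⁻ _, ‖g x‖ₑ ^ 2 ∂P := by
      refine lintegral_congr_ae ?_
      filter_upwards [hX.levy.start] with ω hω
      rw [hω]
    rw [this, lintegral_const, measure_univ, mul_one]
    finiteness
  have hT2 : ∫⁻ ω, (T ω : ENNReal) ^ 2 ∂P ≠ ⊤ := by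
    have h1 : ∫⁻ ω, (exitTime τ a t ω : ENNReal) ^ 2 ∂P = ∫⁻ ω, (T ω : ENNReal) ^ 2 ∂P :=
      lintegral_congr_ae (hTF.mono fun ω hω => by simp only [hω, hTdef])
    exact h1 ▸ (hτ.lintegral_exitTime_sq_lt_top hα hα1 hat).ne
  set C : ENNReal := 2 * (K * ∫⁻ ω, (T ω : ENNReal) ^ 2 ∂P +
    2 * ((∫⁻ ω, ‖g (X 0 ω)‖ₑ ^ 2 ∂P) * (1 + ∫⁻ ω, (T ω : ENNReal) ^ 2 ∂P) +
      K * ∫⁻ ω, (T ω : ENNReal) ^ 2 ∂P)) with hCdef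
  have hC : C ≠ ⊤ := by finiteness
  refine ⟨C.toReal, fun h hh => ?_⟩
  have hae : (fun ω => exactFunctional φ g X (exitTime τ a t) ω -
      discretizedFunctional φ g X (exitTime τ a t) h ω) =ᵐ[P]
      fun ω => (∫ s in (0 : ℝ)..(T ω : ℝ), g (X s.toNNReal ω)) -
        ∑ i ∈ Finset.range ⌊(T ω : ℝ) / h⌋₊, h * g (X (Real.toNNReal (i * h)) ω) := by
    filter_upwards [hTF] with ω hω
    rw [exactFunctional_sub_discretizedFunctional, hω]
  refine memLp_two_and_integral_sq_le ?_ hC (Real.rpow_nonneg hh.le _) ?_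
  · exact (aestronglyMeasurable_integral_sub_riemannSum hG hGm hT h).congr hae.symm
  · refine (lintegral_congr_ae (hae.fun_comp fun r => ‖r‖ₑ ^ 2)).trans_le ?_
    exact lintegral_sq_integral_sub_riemannSum_le hG hGm hT hind (by positivity) hθ1 hKtop hK h0 hh

end FractionalMonteCarlo

theorem proposition3p4 {Ω : Type*} [MeasurableSpace Ω] (P : Measure Ω) [IsProbabilityMeasure P]
    (d : ℕ) (α β γ c L a : ℝ)
    (hα : 0 < α) (hα1 : α < 1) (hβ : 0 < β) (hβ2 : β ≤ 2) (hγ : 0 < γ) (hγβ : γ < β / 2)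
    (hc : 0 < c)
    (τ : ℝ≥0 → Ω → ℝ) (hτ : FractionalMonteCarlo.IsStableSubordinator α τ P)
    (X : EuclideanSpace ℝ (Fin d) → ℝ≥0 → Ω → EuclideanSpace ℝ (Fin d))
    (hX : ∀ x, FractionalMonteCarlo.IsIsotropicStableProcess β c (X x) x P)
    (hXτ : ∀ x, IndepFun (fun ω s => X x s ω) (fun ω s => τ s ω) P)
    (φ g : EuclideanSpace ℝ (Fin d) → ℝ) (hφ : Continuous φ)
    (hg : ∀ x y, |g x - g y| ≤ L * ∑ j, |x j - y j| ^ γ) :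
    ∃ M : ℝ → EuclideanSpace ℝ (Fin d) → ℝ,
      ∀ (t : ℝ) (x : EuclideanSpace ℝ (Fin d)), a < t → ∀ h : ℝ, 0 < h →
        MemLp (fun ω =>
          FractionalMonteCarlo.exactFunctional φ g (X x)
              (FractionalMonteCarlo.exitTime τ a t) ω -
            FractionalMonteCarlo.discretizedFunctional φ g (X x)
              (FractionalMonteCarlo.exitTime τ a t) h ω) 2 P ∧
        ∫ ω, |FractionalMonteCarlo.exactFunctional φ g (X x)
              (FractionalMonteCarlo.exitTime τ a t) ω -
            FractionalMonteCarlo.discretizedFunctional φ g (X x)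
              (FractionalMonteCarlo.exitTime τ a t) h ω| ^ 2 ∂P ≤
          M t x * h ^ (2 * γ / β) := by
  -- The constant must be defined for every `t` before `a < t` is known; for `t ≤ a` the dummy `0`
  -- is used.
  have key : ∀ (t : ℝ) (x : EuclideanSpace ℝ (Fin d)), ∃ M : ℝ, a < t → ∀ h : ℝ, 0 < h → _ :=
    fun t x => by
      by_cases hat : a < t
      · obtain ⟨M, hM⟩ := FractionalMonteCarlo.exists_bound_sq_discretization_error hα hα1 hβ hγ
          hγβ hc hτ (hX x) (hXτ x) φ hg hat
        exact ⟨M, fun _ => hM⟩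
      · exact ⟨0, fun h => absurd h hat⟩
  choose M hM using key
  exact ⟨M, fun t x hat h hh => hM t x hat h hh⟩
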